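/- Let $d \ge 1$ and let $\alpha = (\alpha_1,\dots,\alpha_d)$ be a probability distribution on $[d]=\{1,\dots,d\}$ that is sorted, i.e. $\alpha_1 \ge \alpha_2 \ge \cdots \ge \alpha_d \ge 0$. For $n \in \mathbb{N}$ let $w = (w_1,\dots,w_n)$ be a random word whose letters are drawn independently from $[d]$ according to $\alpha$, and let $\lambda^{(n)} = (\lambda^{(n)}_1 \ge \cdots \ge \lambda^{(n)}_d)$ be the shape (vector of row lengths) of the Young tableaux that the Robinson–Schensted–Knuth (RSK) algorithm assigns to $w$; the law of $\lambda^{(n)}$ is called the Schur–Weyl distribution. For $k \in [d]$ define $$\mathrm{Exc}^{(n)}_k(\alpha) = \mathbb{E}\Bigl[\sum_{i=1}^k \lambda^{(n)}_i\Bigr] - n\sum_{i=1}^k \alpha_i, \qquad \mathrm{ITW}_k(\alpha) = \sum_{i \le k < j} \frac{\alpha_j}{\alpha_i - \alpha_j} \in [0,\infty],$$ where $1 \le i \le k < j \le d$ in the last sum and a summand with $\alpha_i = \alpha_j$ is read as $+\infty$. Then for every $k \in [d]$: 1. $\mathrm{Exc}^{(n)}_k(\alpha) \le \mathrm{ITW}_k(\alpha)$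 for all $n \in \mathbb{N}$. 2. If $\alpha_1,\dots,\alpha_d$ are distinct, then $\mathrm{Exc}^{(n)}_k(\alpha) \nearrow \mathrm{ITW}_k(\alpha)$ as $n \to \infty$; that is, $\mathrm{Exc}^{(n)}_k(\alpha)$ is nondecreasing in $n$ and converges to $\mathrm{ITW}_k(\alpha)$. -/

import Mathlib

open MeasureTheory Filter Topology

/-- Row insertion of the letter `x` into a (weakly increasing) row: `x` replaces the leftmost
entry that is strictly larger than `x`, and that entry is bumped; if there is none, then `x` is
appended at the end of the row and nothing is bumped.  Returns the new row and the bumped letter. -/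
def rowInsert {A : Type*} [LinearOrder A] (x : A) : List A → List A × Option A
  | [] => ([x], none)
  | y :: r =>
      if x < y then (x :: r, some y)
      else (y :: (rowInsert x r).1, (rowInsert x r).2)

/-- Insertion of a letter into a tableau (the list of its rows, from the first row on): insert it
into the first row, insert the bumped letter, if any, into the second row, and so on. -/
def tableauInsert {A : Type*} [LinearOrder A] : List (List A) → A → List (List A)
  | [], x => [[x]]
  | r :: T, x =>
      match (rowInsert x r).2 with
      | none => (rowInsert x r).1 :: T
      | some y => (rowInsert x r).1 :: tableauInsert T y

/-- The insertion tableau of a word under the RSK algorithm: insert the letters of the word one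
after the other, from left to right, into the initially empty tableau. -/
def insertionTableau {A : Type*} [LinearOrder A] (w : List A) : List (List A) :=
  w.foldl tableauInsert []

/-- The shape `(λ₁, …, λ_d)` of the RSK tableaux of a word `w` of length `n` over the alphabet
`Fin d`, as the vector of its row lengths (a tableau over `Fin d` has at most `d` rows; absent rows
have length `0`). -/
def shRSK {n d : ℕ} (w : Fin n → Fin d) : Fin d → ℕ :=
  fun i => ((insertionTableau (List.ofFn w)).getD (i : ℕ) []).length

noncomputable section

/-- The law of one letter: the letter `i` has probability `α i`. -/
def letterLaw {d : ℕ} (α : Fin d → ℝ) : Measure (Fin d) :=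
  ∑ i, ENNReal.ofReal (α i) • Measure.dirac i

/-- The law of the `n`-letter `α`-random word, whose letters are independent with law `α`. -/
def wordLaw {d : ℕ} (n : ℕ) (α : Fin d → ℝ) : Measure (Fin n → Fin d) :=
  Measure.pi fun _ => letterLaw α

/-- The Schur–Weyl distribution: the law of the RSK shape of an `n`-letter `α`-random word. -/
def schurWeyl {d : ℕ} (n : ℕ) (α : Fin d → ℝ) : Measure (Fin d → ℕ) :=
  (wordLaw n α).map shRSK

/-- The excess `E[(λ₁ + ⋯ + λ_k) - (α₁ + ⋯ + α_k) n]` for `λ` drawn from the Schur–Weyl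
distribution.  Here `k : Fin d`, and `Finset.Iic k` is the set of the indices `i ≤ k`. -/
def excess {d : ℕ} (n : ℕ) (k : Fin d) (α : Fin d → ℝ) : ℝ :=
  ∫ l, ((∑ i ∈ Finset.Iic k, (l i : ℝ)) - (∑ i ∈ Finset.Iic k, α i) * (n : ℝ)) ∂(schurWeyl n α)

open Classical in
/-- The quantity `∑_{i ≤ k < j} α_j / (α_i - α_j)`, in the extended reals: a summand
whose denominator vanishes is `+∞`. -/
def itwBound {d : ℕ} (k : Fin d) (α : Fin d → ℝ) : EReal :=
  ∑ i ∈ Finset.Iic k, ∑ j ∈ Finset.Ioi k,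
    if α i = α j then (⊤ : EReal) else ((α j / (α i - α j) : ℝ) : EReal)

end

/-! Row `n` (counted from 0) of the insertion tableau has only letters at least `n`, so the letters
`≤ k` all lie in the rows up to `k`. Their expected number is exactly the centring term, hence the
excess is the expected number of letters larger than `k` in these rows (`excess_eq_wordSum`).

Monotonicity. By Greene's theorem the first rows measure the largest union of disjoint increasing
subsequences. Prepending a letter never shrinks this quantity, and a letter `x ≤ k` enlarges it,
since `x` can be put in front of row `x`. So the number of large letters does not drop when a letter
is prepended (`largeCount_le_cons`); as a word of length `n + 1` is an independent letter followed
by a word of length `n`, the excess is nondecreasing.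

Limit. The numbers of letters `j` in row `i`, for `i < j`, form a Markov chain driven by appended
letters. Inserting a letter is a composition of moves of single queues, each an involution of the
pairs (state, token). For strictly decreasing `α`, give a state the product of geometric laws with
ratios `α j / α i` and a token its letter probability: every move preserves this weight
(`weight_cellMove`), so the product law is stationary (`isStationaryLaw_geomWeight`). A finite set
of states can be emptied by one common word of positive probability, so runs along the same letters
merge (`IsStationaryLaw.tendsto_distinctProb`). With monotonicity, the expected count started from
the empty tableau increases to the stationary mean, where the queue `(i, j)` contributes `ρ / (1 -
ρ) = α j / (α i - α j)`.

Bound. For strictly decreasing `α` it follows from monotone convergence. A tie across `k` makes the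
bound infinite. Other ties are removed by mixing with a strictly decreasing distribution; for fixed
`n` the excess is a polynomial in `α`, and the bound is continuous there. -/

/-! ### Row insertion -/

/-- The row word of a tableau: its rows from the last to the first. -/
def rowWord {A : Type*} (T : List (List A)) : List A := T.reverse.flatten

theorem rowWord_cons {A : Type*} (r : List A) (T : List (List A)) :
    rowWord (r :: T) = rowWord T ++ r := by
  simp [rowWord]

section Insertion

variable {A : Type*} [LinearOrder A]

/-- The letters of the row `s` are larger than the letters of `r` above them. -/
def ColStrict : List A → List A → Prop
  | _, [] => True
  | [], _ :: _ => False
  | a :: r, b :: s => a < b ∧ ColStrict r s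

/-- Semistandard tableaux: sorted rows, strictly increasing columns. -/
structure IsTableau (T : List (List A)) : Prop where
  sorted : ∀ r ∈ T, r.Pairwise (· ≤ ·)
  cols : T.IsChain ColStrict

theorem rowInsert_bump_gt {x y : A} {r : List A} (h : (rowInsert x r).2 = some y) : x < y := by
  induction r with
  | nil => simp [rowInsert] at h
  | cons a r ih =>
    by_cases hx : x < a
    · simp [rowInsert, hx] at h
      exact h ▸ hx
    · simp [rowInsert, hx] at h
      exact ih h

theorem rowInsert_bump_mem {x y : A} {r : List A} (h : (rowInsert x r).2 = some y) : y ∈ r := by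
  induction r with
  | nil => simp [rowInsert] at h
  | cons a r ih =>
    by_cases hx : x < a
    · simp [rowInsert, hx] at h
      simp [h]
    · simp [rowInsert, hx] at h
      exact List.mem_cons_of_mem _ (ih h)

theorem rowInsert_perm (x : A) (r : List A) :
    ((rowInsert x r).2.toList ++ (rowInsert x r).1).Perm (x :: r) := by
  induction r with
  | nil => simp [rowInsert]
  | cons a r ih =>
    by_cases hx : x < a
    · simp only [rowInsert, hx, if_true, Option.toList_some, List.singleton_append]
      exact List.Perm.swap _ _ _
    · simp only [rowInsert, hx, if_false]
      exact List.perm_middle.trans ((ih.cons a).trans (List.Perm.swap _ _ _))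

theorem mem_of_mem_rowInsert {x z : A} {r : List A} (h : z ∈ (rowInsert x r).1) :
    z = x ∨ z ∈ r := by
  have := (rowInsert_perm x r).subset (List.mem_append_right _ h)
  simpa using this

theorem rowInsert_ne_nil (x : A) (r : List A) : (rowInsert x r).1 ≠ [] := by
  cases r with
  | nil => simp [rowInsert]
  | cons a r => by_cases hx : x < a <;> simp [rowInsert, hx]

theorem rowInsert_sorted (x : A) {r : List A} (h : r.Pairwise (· ≤ ·)) :
    (rowInsert x r).1.Pairwise (· ≤ ·) := by
  induction r with
  | nil => simp [rowInsert]
  | cons a r ih =>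
    rw [List.pairwise_cons] at h
    by_cases hx : x < a
    · simp only [rowInsert, hx, if_true, List.pairwise_cons]
      exact ⟨fun b hb => hx.le.trans (h.1 b hb), h.2⟩
    · simp only [rowInsert, hx, if_false, List.pairwise_cons]
      refine ⟨fun b hb => ?_, ih h.2⟩
      rcases mem_of_mem_rowInsert hb with rfl | hb
      · exact not_lt.1 hx
      · exact h.1 b hb

theorem rowInsert_bump_none {x : A} {r : List A} (h : (rowInsert x r).2 = none) :
    ∀ z ∈ r, z ≤ x := by
  induction r with
  | nil => simp
  | cons a r ih =>
    by_cases hx : x < a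
    · simp [rowInsert, hx] at h
    · simp [rowInsert, hx] at h
      simpa using ⟨not_lt.1 hx, ih h⟩

theorem rowInsert_bump_min {x y : A} {r : List A} (hr : r.Pairwise (· ≤ ·))
    (h : (rowInsert x r).2 = some y) : ∀ z ∈ r, x < z → y ≤ z := by
  induction r with
  | nil => simp
  | cons a r ih =>
    rw [List.pairwise_cons] at hr
    by_cases hx : x < a
    · simp [rowInsert, hx] at h
      subst h
      simpa using fun z hz _ => hr.1 z hz
    · simp [rowInsert, hx] at h
      simpa using ⟨fun h' => absurd h' hx, ih hr.2 h⟩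

theorem rowInsert_head_le {x c : A} {r t : List A} (h : (rowInsert x r).1 = c :: t) : c ≤ x := by
  cases r with
  | nil => simp [rowInsert] at h; exact h.1.ge
  | cons a r =>
    by_cases hx : x < a
    · simp [rowInsert, hx] at h; exact h.1.ge
    · simp [rowInsert, hx] at h; exact h.1 ▸ not_lt.1 hx

theorem ColStrict.rowInsert_top (x : A) {r s : List A} (h : ColStrict r s) :
    ColStrict (rowInsert x r).1 s := by
  induction r generalizing s with
  | nil => cases s with
    | nil => simp [ColStrict]
    | cons b s => exact h.elim
  | cons a r ih => cases s with
    | nil => simp [ColStrict]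
    | cons b s =>
      by_cases hx : x < a
      · simp only [rowInsert, hx, if_true, ColStrict]
        exact ⟨hx.trans h.1, h.2⟩
      · simp only [rowInsert, hx, if_false, ColStrict]
        exact ⟨h.1, ih h.2⟩

/-- The letter below the bumped `y` exceeds `y`, so `y` settles in the next row no further right
than the column it left; above it there is now `x` or a letter at most `x`. -/
theorem ColStrict.rowInsert_bump {x y : A} {r s : List A} (h : ColStrict r s)
    (hy : (rowInsert x r).2 = some y) : ColStrict (rowInsert x r).1 (rowInsert y s).1 := by
  induction r generalizing s with
  | nil => simp [rowInsert] at hy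
  | cons a r ih =>
    have hxy := rowInsert_bump_gt hy
    by_cases hx : x < a
    · simp only [rowInsert, hx, if_true, Option.some.injEq] at hy ⊢
      subst hy
      cases s with
      | nil => simp [rowInsert, ColStrict, hx]
      | cons b s =>
        have hab : a < b := h.1
        simpa [rowInsert, hab, ColStrict, hx] using h.2
    · simp only [rowInsert, hx, if_false] at hy ⊢
      have hay : a < y := (not_lt.1 hx).trans_lt hxy
      cases s with
      | nil => simp [rowInsert, ColStrict, hay]
      | cons b s =>
        by_cases hyb : y < b
        · simp only [rowInsert, hyb, if_true, ColStrict]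
          exact ⟨hay, h.2.rowInsert_top x⟩
        · simp only [rowInsert, hyb, if_false, ColStrict]
          exact ⟨h.1, ih h.2 hy⟩

theorem tableauInsert_cons_none {x : A} {r : List A} (T : List (List A))
    (h : (rowInsert x r).2 = none) : tableauInsert (r :: T) x = (rowInsert x r).1 :: T := by
  rw [tableauInsert, h]

theorem tableauInsert_cons_some {x y : A} {r : List A} (T : List (List A))
    (h : (rowInsert x r).2 = some y) :
    tableauInsert (r :: T) x = (rowInsert x r).1 :: tableauInsert T y := by
  rw [tableauInsert, h]

theorem head?_tableauInsert (T : List (List A)) (x : A) :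
    (tableauInsert T x).head? = some (rowInsert x (T.headD [])).1 := by
  cases T with
  | nil => simp [tableauInsert, rowInsert]
  | cons r T =>
    cases h : (rowInsert x r).2 with
    | none => simp [tableauInsert_cons_none T h]
    | some y => simp [tableauInsert_cons_some T h]

theorem IsTableau.tail {r : List A} {T : List (List A)} (h : IsTableau (r :: T)) : IsTableau T :=
  ⟨fun s hs => h.sorted s (List.mem_cons_of_mem _ hs), h.cols.tail⟩

theorem IsTableau.insert_letter {T : List (List A)} (h : IsTableau T) (x : A) :
    IsTableau (tableauInsert T x) := by
  induction T generalizing x with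
  | nil => exact ⟨by simp [tableauInsert], by simp [tableauInsert]⟩
  | cons r T ih =>
    have hr := rowInsert_sorted x (h.sorted r List.mem_cons_self)
    have hc := List.isChain_cons.1 h.cols
    cases hy : (rowInsert x r).2 with
    | none =>
      rw [tableauInsert_cons_none T hy]
      refine ⟨?_, List.isChain_cons.2 ⟨fun s hs => (hc.1 s hs).rowInsert_top x, hc.2⟩⟩
      simpa using ⟨hr, h.tail.sorted⟩
    | some y =>
      rw [tableauInsert_cons_some T hy]
      refine ⟨?_, List.isChain_cons.2 ⟨fun s hs => ?_, (ih h.tail y).cols⟩⟩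
      · simpa using ⟨hr, (ih h.tail y).sorted⟩
      · rw [head?_tableauInsert] at hs
        obtain rfl : _ = s := by simpa using hs
        refine ColStrict.rowInsert_bump ?_ hy
        cases T with
        | nil => simp [ColStrict]
        | cons s T => exact hc.1 s (by simp)

theorem insertionTableau_append_singleton (w : List A) (x : A) :
    insertionTableau (w ++ [x]) = tableauInsert (insertionTableau w) x := by
  simp [insertionTableau]

theorem isTableau_insertionTableau (w : List A) : IsTableau (insertionTableau w) := by
  induction w using List.reverseRecOn with
  | nil => exact ⟨by simp [insertionTableau], by simp [insertionTableau]⟩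
  | append_singleton w x ih =>
    rw [insertionTableau_append_singleton]
    exact ih.insert_letter x

/-! ### Knuth equivalence -/

/-- Knuth equivalence of words. -/
inductive Knuth : List A → List A → Prop
  | refl (u) : Knuth u u
  | symm {u v} : Knuth u v → Knuth v u
  | trans {u v w} : Knuth u v → Knuth v w → Knuth u w
  | move_left {x y z : A} (p q : List A) (h : x < y) (h' : y ≤ z) :
      Knuth (p ++ y :: z :: x :: q) (p ++ y :: x :: z :: q)
  | move_right {x y z : A} (p q : List A) (h : x ≤ y) (h' : y < z) :
      Knuth (p ++ x :: z :: y :: q) (p ++ z :: x :: y :: q)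

theorem Knuth.append {u v : List A} (h : Knuth u v) (p q : List A) :
    Knuth (p ++ u ++ q) (p ++ v ++ q) := by
  induction h with
  | refl u => exact .refl _
  | symm _ ih => exact ih.symm
  | trans _ _ ih ih' => exact ih.trans ih'
  | move_left p' q' h h' => simpa using Knuth.move_left (p ++ p') (q' ++ q) h h'
  | move_right p' q' h h' => simpa using Knuth.move_right (p ++ p') (q' ++ q) h h'

theorem Knuth.append_left {u v : List A} (h : Knuth u v) (p : List A) :
    Knuth (p ++ u) (p ++ v) := by simpa using h.append p []

theorem Knuth.append_right {u v : List A} (h : Knuth u v) (q : List A) :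
    Knuth (u ++ q) (v ++ q) := by simpa using h.append [] q

/-- The letter `x` slides left past one letter of `r` at a time; the left neighbour of that letter,
being larger than `x`, licenses the exchange. -/
theorem knuth_move_to_front {x y : A} {r : List A} (hx : x < y) (hr : (y :: r).Pairwise (· ≤ ·)) :
    Knuth (y :: r ++ [x]) (y :: x :: r) := by
  induction r generalizing y with
  | nil => exact .refl _
  | cons a r ih =>
    have hya : y ≤ a := List.rel_of_pairwise_cons hr List.mem_cons_self
    have h1 := (ih (hx.trans_le hya) hr.of_cons).append_left [y]
    exact h1.trans (Knuth.move_left [] r hx hya)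

theorem knuth_rowInsert (x : A) {r : List A} (hr : r.Pairwise (· ≤ ·)) :
    Knuth (r ++ [x]) ((rowInsert x r).2.toList ++ (rowInsert x r).1) := by
  induction r with
  | nil => exact .refl _
  | cons y r ih =>
    by_cases hx : x < y
    · simpa [rowInsert, hx] using knuth_move_to_front hx hr
    · simp only [rowInsert, hx, if_false]
      have h1 : Knuth (y :: r ++ [x]) _ := (ih hr.of_cons).append_left [y]
      refine h1.trans ?_
      cases hb : (rowInsert x r).2 with
      | none => exact .refl _
      | some b =>
        obtain ⟨c, t, hc⟩ := List.exists_cons_of_ne_nil (rowInsert_ne_nil x r)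
        have hcb : c < b := (rowInsert_head_le hc).trans_lt (rowInsert_bump_gt hb)
        have hyc : y ≤ c := by
          rcases mem_of_mem_rowInsert (x := x) (r := r) (z := c) (by simp [hc]) with rfl | h
          · exact not_lt.1 hx
          · exact List.rel_of_pairwise_cons hr h
        rw [hc]
        -- The bumped letter `b` passes in front of `y`, with the head `c` of the new row as
        -- witness: `y ≤ c < b`.
        exact Knuth.move_right [] t hyc hcb

theorem knuth_tableauInsert {T : List (List A)} (h : ∀ r ∈ T, r.Pairwise (· ≤ ·)) (x : A) :
    Knuth (rowWord T ++ [x]) (rowWord (tableauInsert T x)) := by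
  induction T generalizing x with
  | nil => simpa [rowWord, tableauInsert] using Knuth.refl [x]
  | cons r T ih =>
    have h1 := (knuth_rowInsert x (h r List.mem_cons_self)).append_left (rowWord T)
    rw [rowWord_cons, List.append_assoc]
    refine h1.trans ?_
    cases hy : (rowInsert x r).2 with
    | none => simpa [tableauInsert_cons_none T hy, rowWord_cons] using Knuth.refl _
    | some y =>
      rw [tableauInsert_cons_some T hy, rowWord_cons]
      have := (ih (fun s hs => h s (List.mem_cons_of_mem _ hs)) y).append_right (rowInsert x r).1
      simpa using this

theorem knuth_insertionTableau (w : List A) : Knuth w (rowWord (insertionTableau w)) := by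
  induction w using List.reverseRecOn with
  | nil => exact .refl _
  | append_singleton w x ih =>
    rw [insertionTableau_append_singleton]
    exact (ih.append_right [x]).trans
      (knuth_tableauInsert (isTableau_insertionTableau w).sorted x)

end Insertion

/-! ### Row words and column labels -/

section Labels

variable {A : Type*}

/-- The number of cells in the first `k` rows. -/
def topSize (k : ℕ) (T : List (List A)) : ℕ := ((T.take k).map List.length).sum

/-- The row word of a tableau with each letter labelled by its column. -/
def columnWord (T : List (List A)) : List (A × ℕ) := (T.map List.zipIdx).reverse.flatten

theorem columnWord_cons (r : List A) (T : List (List A)) :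
    columnWord (r :: T) = columnWord T ++ r.zipIdx := by
  simp [columnWord]

theorem map_fst_columnWord (T : List (List A)) : (columnWord T).map Prod.fst = rowWord T := by
  induction T with
  | nil => rfl
  | cons r T ih => simp [columnWord_cons, rowWord_cons, ih, List.zipIdx_map_fst]

theorem countP_zipIdx (r : List A) (c : ℕ) :
    (r.zipIdx.countP fun p => p.2 = c) = if c < r.length then 1 else 0 := by
  have : (r.zipIdx.countP fun p => p.2 = c) = (r.zipIdx.map Prod.snd).count c := by
    rw [List.count, List.countP_map]; rfl
  rw [this, List.zipIdx_map_snd]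
  have hn : (List.range' 0 r.length).Nodup := List.nodup_range'
  rw [hn.count]
  simp

theorem sum_countP_length (T : List (List A)) (C : ℕ) (hC : ∀ r ∈ T, r.length ≤ C) :
    ∑ c ∈ Finset.range C, (T.countP fun r => c < r.length) = (T.map List.length).sum := by
  induction T with
  | nil => simp
  | cons r T ih =>
    simp only [List.countP_cons, Finset.sum_add_distrib, List.map_cons, List.sum_cons]
    rw [ih fun s hs => hC s (List.mem_cons_of_mem _ hs), add_comm]
    have := hC r List.mem_cons_self
    have h1 : (Finset.range C).filter (fun c => c < r.length) = Finset.range r.length := by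
      ext c; simp; omega
    simp [h1]

end Labels

/-! ### Disjoint increasing subsequences -/

section Chains

variable {A : Type*} [LinearOrder A]

/-- `σ'` arises from the multiset `σ` of final letters of increasing sequences when one of the
sequences is continued by the letter `x`. -/
def Extends (x : A) (σ σ' : Multiset A) : Prop :=
  ∃ a τ, σ = a ::ₘ τ ∧ a ≤ x ∧ σ' = x ::ₘ τ

/-- Increasing sequences with final letters `σ` can be continued disjointly, within the word, by
`N` letters in total. -/
def Chains : List A → Multiset A → ℕ → Prop
  | [], _, N => N = 0
  | x :: v, σ, N => Chains v σ N ∨ ∃ σ' M, Extends x σ σ' ∧ N = M + 1 ∧ Chains v σ' M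

theorem Chains.skip {x : A} {v : List A} {σ : Multiset A} {N : ℕ} (h : Chains v σ N) :
    Chains (x :: v) σ N := Or.inl h

theorem Chains.take {x : A} {v : List A} {σ σ' : Multiset A} {N : ℕ} (hx : Extends x σ σ')
    (h : Chains v σ' N) : Chains (x :: v) σ (N + 1) := Or.inr ⟨σ', N, hx, rfl, h⟩

/-- A sequence ending in the smaller `a` accepts every letter that one ending in `b` accepts. -/
theorem Chains.anti {v : List A} {a b : A} {τ : Multiset A} {N : ℕ} (hab : a ≤ b)
    (h : Chains v (b ::ₘ τ) N) : Chains v (a ::ₘ τ) N := by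
  induction v generalizing a b τ N with
  | nil => exact h
  | cons x v ih =>
    rcases h with h | ⟨σ', M, ⟨e, ρ, he, hex, rfl⟩, rfl, h⟩
    · exact (ih hab h).skip
    · rcases Multiset.cons_eq_cons.1 he with ⟨rfl, rfl⟩ | ⟨-, cs, rfl, rfl⟩
      · exact Chains.take ⟨a, _, rfl, hab.trans hex, rfl⟩ h
      · refine Chains.take ⟨e, a ::ₘ cs, Multiset.cons_swap _ _ _, hex, rfl⟩ ?_
        rw [Multiset.cons_swap] at h ⊢
        exact ih hab h

theorem Chains.weaken {v : List A} {τ : Multiset A} {N : ℕ} (b : A) (h : Chains v τ N) :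
    Chains v (b ::ₘ τ) N := by
  induction v generalizing τ N with
  | nil => exact h
  | cons x v ih =>
    rcases h with h | ⟨σ', M, ⟨e, ρ, rfl, hex, rfl⟩, rfl, h⟩
    · exact (ih h).skip
    · refine Chains.take ⟨e, b ::ₘ ρ, Multiset.cons_swap _ _ _, hex, rfl⟩ ?_
      rw [Multiset.cons_swap]
      exact ih h

theorem Chains.append_congr {u v : List A} (h : ∀ σ N, Chains u σ N ↔ Chains v σ N) (p : List A)
    (σ : Multiset A) (N : ℕ) : Chains (p ++ u) σ N ↔ Chains (p ++ v) σ N := by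
  induction p generalizing σ N with
  | nil => exact h σ N
  | cons x p ih => simp only [List.cons_append, Chains, ih]

/-- No sequence can take `z` and then `x`, so when both letters are used they belong to different
sequences and their order is irrelevant. -/
theorem Chains.swap {x z : A} {q : List A} {σ : Multiset A} {N : ℕ} (hxz : x < z)
    (h : Chains (z :: x :: q) σ N) : Chains (x :: z :: q) σ N := by
  rcases h with (h | ⟨σ', M, hx, rfl, h⟩) | ⟨σ', M, hz, rfl, h | ⟨σ'', M, hx, rfl, h⟩⟩
  · exact h.skip.skip
  · exact Chains.take hx h.skip
  · exact (Chains.take hz h).skip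
  · obtain ⟨b, τ, rfl, hb, rfl⟩ := hz
    obtain ⟨a, ρ, ha, hax, rfl⟩ := hx
    rcases Multiset.cons_eq_cons.1 ha with ⟨rfl, rfl⟩ | ⟨-, cs, rfl, rfl⟩
    · exact absurd hxz hax.not_gt
    · refine Chains.take ⟨a, b ::ₘ cs, Multiset.cons_swap _ _ _, hax, rfl⟩
        (Chains.take ⟨b, x ::ₘ cs, Multiset.cons_swap _ _ _, hb, Multiset.cons_swap _ _ _⟩ h)

/-- The exchange fails only when a single sequence takes `x` and then `z`; the second alternative
records this case. -/
theorem Chains.swap_or {x z : A} {q : List A} {σ : Multiset A} {N : ℕ}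
    (h : Chains (x :: z :: q) σ N) : Chains (z :: x :: q) σ N ∨
      ∃ a τ M, σ = a ::ₘ τ ∧ a ≤ x ∧ N = M + 2 ∧ Chains q (z ::ₘ τ) M := by
  rcases h with (h | ⟨σ', M, hx, rfl, h⟩) | ⟨σ', M, hz, rfl, h | ⟨σ'', M, hx, rfl, h⟩⟩
  · exact Or.inl h.skip.skip
  · exact Or.inl (Chains.take hx h.skip)
  · exact Or.inl (Chains.take hz h).skip
  · obtain ⟨a, τ, rfl, ha, rfl⟩ := hz
    obtain ⟨b, ρ, hb, hbz, rfl⟩ := hx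
    rcases Multiset.cons_eq_cons.1 hb with ⟨rfl, rfl⟩ | ⟨-, cs, rfl, rfl⟩
    · exact Or.inr ⟨a, τ, M, rfl, ha, rfl, h⟩
    · refine Or.inl (Chains.take ⟨b, a ::ₘ cs, Multiset.cons_swap _ _ _, hbz, rfl⟩
        (Chains.take ⟨a, z ::ₘ cs, Multiset.cons_swap _ _ _, ha, Multiset.cons_swap _ _ _⟩ h))

/-- The case to repair is a sequence through `x, z`. If `y` is free, it takes `y, z` instead. If `y`
belongs to another sequence, the two exchange tails: that one goes on to `z`, the first stops at
`x`, and ending in `x` rather than `y` only helps. -/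
theorem chains_move_left {x y z : A} (q : List A) (hxy : x < y) (hyz : y ≤ z) (σ : Multiset A)
    (N : ℕ) : Chains (y :: z :: x :: q) σ N ↔ Chains (y :: x :: z :: q) σ N := by
  have hxz := hxy.trans_le hyz
  constructor
  · rintro (h | ⟨σ', M, hy, rfl, h⟩)
    · exact (h.swap hxz).skip
    · exact Chains.take hy (h.swap hxz)
  · rintro (h | ⟨σ', M, hy, rfl, h⟩)
    · rcases h.swap_or with h | ⟨a, τ, M, rfl, ha, rfl, h'⟩
      · exact h.skip
      · exact Chains.take ⟨a, τ, rfl, ha.trans hxy.le, rfl⟩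
          (Chains.take ⟨y, τ, rfl, hyz, rfl⟩ h'.skip)
    · rcases h.swap_or with h | ⟨a, τ, M, rfl, ha, rfl, h'⟩
      · exact Chains.take hy h
      · obtain ⟨e, ρ, rfl, he, hc⟩ := hy
        rcases Multiset.cons_eq_cons.1 hc with ⟨rfl, rfl⟩ | ⟨-, cs, rfl, rfl⟩
        · exact absurd hxy ha.not_gt
        · refine Chains.take ⟨e, _, rfl, he, rfl⟩ (Chains.take ⟨y, _, rfl, hyz, rfl⟩
            (Chains.take ⟨a, z ::ₘ cs, Multiset.cons_swap _ _ _, ha, rfl⟩ ?_))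
          rw [Multiset.cons_swap] at h'
          exact h'.anti hxy.le

/-- Again a sequence through `x, z` is rerouted, to `x, y`. If `y` is free, the new final letter `y`
is smaller than `z`; if another sequence takes `y`, that one takes `z` instead and the final letters
agree. -/
theorem chains_move_right {x y z : A} (q : List A) (hxy : x ≤ y) (hyz : y < z) (σ : Multiset A)
    (N : ℕ) : Chains (x :: z :: y :: q) σ N ↔ Chains (z :: x :: y :: q) σ N := by
  refine ⟨fun h => ?_, fun h => h.swap (hxy.trans_lt hyz)⟩
  rcases h.swap_or with h | ⟨a, τ, M, rfl, ha, rfl, h | ⟨σ', M, ⟨e, ρ, he, hey, rfl⟩, rfl, h⟩⟩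
  · exact h
  · exact (Chains.take ⟨a, τ, rfl, ha, rfl⟩
      (Chains.take ⟨x, τ, rfl, hxy, rfl⟩ (h.anti hyz.le))).skip
  · rcases Multiset.cons_eq_cons.1 he with ⟨rfl, rfl⟩ | ⟨-, cs, rfl, rfl⟩
    · exact absurd hyz hey.not_gt
    · exact Chains.take ⟨e, a ::ₘ cs, Multiset.cons_swap _ _ _, hey.trans hyz.le, rfl⟩
        (Chains.take ⟨a, z ::ₘ cs, Multiset.cons_swap _ _ _, ha, rfl⟩
          (Chains.take ⟨x, _, rfl, hxy, rfl⟩ h))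

/-- The invariance half of Greene's theorem, for sequences with prescribed starting letters. -/
theorem Knuth.chains_iff {u v : List A} (h : Knuth u v) (σ : Multiset A) (N : ℕ) :
    Chains u σ N ↔ Chains v σ N := by
  induction h generalizing σ N with
  | refl u => rfl
  | symm _ ih => exact (ih σ N).symm
  | trans _ _ ih ih' => exact (ih σ N).trans (ih' σ N)
  | move_left p q h h' => exact Chains.append_congr (chains_move_left q h h') p σ N
  | move_right p q h h' => exact Chains.append_congr (chains_move_right q h h') p σ N

/-! ### The lower bound in Greene's theorem -/

theorem Chains.skip_append {v : List A} {σ : Multiset A} {N : ℕ} (h : Chains v σ N)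
    (r : List A) : Chains (r ++ v) σ N := by
  induction r with
  | nil => exact h
  | cons x r ih => exact ih.skip

theorem Chains.take_append {v r : List A} {a : A} {τ : Multiset A} {N : ℕ} (h : Chains v τ N)
    (hr : (a :: r).Pairwise (· ≤ ·)) : Chains (r ++ v) (a ::ₘ τ) (N + r.length) := by
  induction r generalizing a with
  | nil => exact h.weaken a
  | cons x r ih =>
    exact Chains.take ⟨a, τ, rfl, List.rel_of_pairwise_cons hr List.mem_cons_self, rfl⟩
      (ih hr.of_cons)

/-- The first `k` rows are themselves disjoint increasing sequences and the other rows are skipped.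
The least letter `a` stands for an empty sequence; `v` and `τ` carry the part of the word already
treated, since the row word ends with the first row. -/
theorem chains_rowWord_append {T : List (List A)} (hT : ∀ r ∈ T, r.Pairwise (· ≤ ·)) {a : A}
    (ha : ∀ b, a ≤ b) (k : ℕ) {v : List A} {τ : Multiset A} {N : ℕ} (h : Chains v τ N) :
    Chains (rowWord T ++ v) (Multiset.replicate k a + τ) (N + topSize k T) := by
  induction T generalizing k v τ N with
  | nil =>
    induction k with
    | zero => simpa [rowWord, topSize] using h
    | succ k ih =>
      rw [Multiset.replicate_succ, Multiset.cons_add]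
      simpa [topSize] using ih.weaken a
  | cons r T ih =>
    have hT' : ∀ r ∈ T, r.Pairwise (· ≤ ·) := fun s hs => hT s (List.mem_cons_of_mem _ hs)
    rw [rowWord_cons, List.append_assoc]
    cases k with
    | zero => simpa [topSize] using ih hT' 0 (h.skip_append r)
    | succ k =>
      have h1 := h.take_append (List.pairwise_cons.2 ⟨fun b _ => ha b, hT r List.mem_cons_self⟩)
      have h2 := ih hT' k h1
      rw [Multiset.add_cons] at h2
      rw [Multiset.replicate_succ, Multiset.cons_add]
      convert h2 using 1
      simp [topSize]
      ring

/-- If row `m < k` has only letters `≥ x`, then prepending `x` allows one more letter. -/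
theorem chains_cons_rowWord_append {T : List (List A)} (hT : ∀ r ∈ T, r.Pairwise (· ≤ ·)) {a : A}
    (ha : ∀ b, a ≤ b) {k m : ℕ} (hm : m < k) {x : A} (hx : ∀ b ∈ T.getD m [], x ≤ b)
    {v : List A} {τ : Multiset A} {N : ℕ} (h : Chains v τ N) :
    Chains (rowWord T ++ v) (x ::ₘ (Multiset.replicate (k - 1) a + τ)) (N + topSize k T) := by
  induction T generalizing k m v τ N with
  | nil =>
    have := chains_rowWord_append (T := []) (by simp) ha (k - 1) h
    simpa [topSize] using this.weaken x
  | cons r T ih =>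
    have hT' : ∀ r ∈ T, r.Pairwise (· ≤ ·) := fun s hs => hT s (List.mem_cons_of_mem _ hs)
    obtain ⟨k, rfl⟩ : ∃ k', k = k' + 1 := ⟨k - 1, by omega⟩
    rw [rowWord_cons, List.append_assoc]
    have hsize : topSize (k + 1) (r :: T) = r.length + topSize k T := by simp [topSize]
    cases m with
    | zero =>
      have h1 := h.take_append (a := x)
        (List.pairwise_cons.2 ⟨fun b hb => hx b (by simpa using hb), hT r List.mem_cons_self⟩)
      have h2 := chains_rowWord_append hT' ha k h1
      rw [Multiset.add_cons] at h2
      rw [Nat.add_sub_cancel, hsize, ← add_assoc]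
      exact h2
    | succ m =>
      have h1 := h.take_append (List.pairwise_cons.2 ⟨fun b _ => ha b, hT r List.mem_cons_self⟩)
      have h2 := ih hT' (m := m) (k := k) (by omega) (by simpa using hx) h1
      obtain ⟨k, rfl⟩ : ∃ k', k = k' + 1 := ⟨k - 1, by omega⟩
      rw [Multiset.add_cons] at h2
      simp only [Nat.add_sub_cancel] at h2 ⊢
      rw [Multiset.replicate_succ, Multiset.cons_add]
      convert h2 using 1
      omega

/-! ### The column bound -/

open Classical in
/-- If the letters of each column `c` of a labelled word decrease, then increasing sequences use a
column at most once each. -/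
theorem Chains.le_columns {v : List (A × ℕ)} (hv : v.Pairwise fun p q => p.2 = q.2 → q.1 < p.1)
    {σ : Multiset A} {N : ℕ} (h : Chains (v.map Prod.fst) σ N) (C : ℕ) (hC : ∀ p ∈ v, p.2 < C) :
    N ≤ ∑ c ∈ Finset.range C, min (v.countP fun p => p.2 = c)
      (σ.countP fun a => ∃ p ∈ v, p.2 = c ∧ a ≤ p.1) := by
  induction v generalizing σ N with
  | nil => simp [Chains] at h; simp [h]
  | cons p v ih =>
    rw [List.pairwise_cons] at hv
    have hC' : ∀ p ∈ v, p.2 < C := fun q hq => hC q (List.mem_cons_of_mem _ hq)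
    rcases h with h | ⟨σ', M, ⟨a, τ, rfl, hap, rfl⟩, rfl, h⟩
    · refine (ih hv.2 h hC').trans (Finset.sum_le_sum fun c _ => min_le_min ?_ ?_)
      · rw [List.countP_cons]; omega
      · simp only [Multiset.countP_eq_card_filter]
        refine Multiset.card_le_card (Multiset.monotone_filter_right _ ?_)
        rintro b ⟨q, hq, h⟩
        exact ⟨q, List.mem_cons_of_mem _ hq, h⟩
    · have hp : p.2 ∈ Finset.range C := Finset.mem_range.2 (hC p List.mem_cons_self)
      refine Nat.succ_le_of_lt ((ih hv.2 h hC').trans_lt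
        (Finset.sum_lt_sum (fun c _ => min_le_min ?_ ?_) ⟨p.2, hp, ?_⟩))
      · rw [List.countP_cons]; omega
      · rw [Multiset.countP_cons, Multiset.countP_cons]
        refine Nat.add_le_add ?_ ?_
        · simp only [Multiset.countP_eq_card_filter]
          refine Multiset.card_le_card (Multiset.monotone_filter_right _ ?_)
          rintro b ⟨q, hq, h⟩
          exact ⟨q, List.mem_cons_of_mem _ hq, h⟩
        · split_ifs with h1 h2
          · rfl
          · obtain ⟨q, hq, hqc, hpq⟩ := h1
            exact absurd ⟨q, List.mem_cons_of_mem _ hq, hqc, hap.trans hpq⟩ h2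
          · simp
          · rfl
      -- Using `p` lowers both arguments of the minimum for its column: `p` is no longer ahead, and
      -- the sequence now ending in `p.1` finds no later letter of that column large enough.
      · have h1 : ¬ ∃ q ∈ v, q.2 = p.2 ∧ p.1 ≤ q.1 := by
          rintro ⟨q, hq, hqp, hpq⟩
          exact (hv.1 q hq hqp.symm).not_ge hpq
        have h2 : ∃ q ∈ p :: v, q.2 = p.2 ∧ a ≤ q.1 := ⟨p, List.mem_cons_self, rfl, hap⟩
        have h3 : Multiset.countP (fun a => ∃ q ∈ v, q.2 = p.2 ∧ a ≤ q.1) τ ≤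
            Multiset.countP (fun a => ∃ q ∈ p :: v, q.2 = p.2 ∧ a ≤ q.1) τ := by
          simp only [Multiset.countP_eq_card_filter]
          refine Multiset.card_le_card (Multiset.monotone_filter_right _ ?_)
          rintro b ⟨q, hq, h⟩
          exact ⟨q, List.mem_cons_of_mem _ hq, h⟩
        rw [Multiset.countP_cons, Multiset.countP_cons, if_neg h1, if_pos h2, List.countP_cons]
        simp only [decide_true, if_true]
        omega

theorem ColStrict.getElem {r s : List A} (h : ColStrict r s) {j : ℕ} {b : A}
    (hj : s[j]? = some b) : ∃ a, r[j]? = some a ∧ a < b := by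
  induction s generalizing r j with
  | nil => simp at hj
  | cons c s ih => cases r with
    | nil => exact h.elim
    | cons a r => cases j with
      | zero => simp at hj ⊢; exact hj ▸ h.1
      | succ j => simpa using ih h.2 (by simpa using hj)

theorem ColStrict.length_le {r s : List A} (h : ColStrict r s) : s.length ≤ r.length := by
  induction s generalizing r with
  | nil => simp
  | cons c s ih => cases r with
    | nil => exact h.elim
    | cons a r => simpa using ih h.2

theorem IsTableau.columnWord_lt {r : List A} {T : List (List A)} (h : IsTableau (r :: T)) {b : A}
    {j : ℕ} (hb : (b, j) ∈ columnWord T) : ∃ a, r[j]? = some a ∧ a < b := by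
  induction T generalizing r with
  | nil => simp [columnWord] at hb
  | cons s T ih =>
    have hrs : ColStrict r s := (List.isChain_cons_cons.1 h.cols).1
    rw [columnWord_cons, List.mem_append] at hb
    rcases hb with hb | hb
    · obtain ⟨c, hc, hcb⟩ := ih h.tail hb
      obtain ⟨a, ha, hac⟩ := hrs.getElem hc
      exact ⟨a, ha, hac.trans hcb⟩
    · rw [List.mem_zipIdx_iff_getElem?] at hb
      exact hrs.getElem hb

/-- The row word reads each column from bottom to top. -/
theorem IsTableau.pairwise_columnWord {T : List (List A)} (h : IsTableau T) :
    (columnWord T).Pairwise fun p q => p.2 = q.2 → q.1 < p.1 := by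
  induction T with
  | nil => simp [columnWord]
  | cons r T ih =>
    rw [columnWord_cons, List.pairwise_append]
    refine ⟨ih h.tail, ?_, ?_⟩
    · have : (r.zipIdx.map Prod.snd).Pairwise (· ≠ ·) := by
        rw [List.zipIdx_map_snd]
        exact List.nodup_range'
      rw [List.pairwise_map] at this
      exact this.imp fun h h' => absurd h' h
    · rintro ⟨b, j⟩ hb ⟨a, j'⟩ ha rfl
      obtain ⟨a', ha', hab⟩ := h.columnWord_lt hb
      rw [List.mem_zipIdx_iff_getElem?] at ha
      simp_all

/-- Each column occupies an initial segment of the rows, so the left side counts its cells in the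
first `k` rows. -/
theorem IsTableau.min_countP_columnWord {T : List (List A)} (h : IsTableau T) (k c : ℕ) :
    min ((columnWord T).countP fun p => p.2 = c) k =
      (T.take k).countP fun r => c < r.length := by
  induction T generalizing k with
  | nil => simp [columnWord]
  | cons r T ih =>
    cases k with
    | zero => simp
    | succ k =>
      rw [columnWord_cons, List.countP_append, countP_zipIdx, List.take_succ_cons,
        List.countP_cons, ← ih h.tail k]
      by_cases hc : c < r.length
      · simp only [hc, if_true, decide_true]; omega
      · have h0 : ((columnWord T).countP fun p => p.2 = c) = 0 := by
          rw [List.countP_eq_zero]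
          rintro ⟨b, j⟩ hb
          obtain ⟨a, ha, -⟩ := h.columnWord_lt hb
          have := (List.getElem?_eq_some_iff.1 ha).1
          simp only [decide_eq_true_eq]
          omega
        simp [h0, hc]

theorem IsTableau.length_le_head {r s : List A} {T : List (List A)} (h : IsTableau (r :: T))
    (hs : s ∈ r :: T) : s.length ≤ r.length := by
  induction T generalizing r with
  | nil => simp at hs; rw [hs]
  | cons t T ih =>
    rcases List.mem_cons.1 hs with rfl | hs
    · exact le_rfl
    · exact (ih h.tail hs).trans (List.isChain_cons_cons.1 h.cols).1.length_le

/-- The upper bound in Greene's theorem: the sequences use each column at most as often as its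
height and as their number allow; summing over columns gives the cells of the top rows. -/
theorem IsTableau.chains_le {T : List (List A)} (h : IsTableau T) {σ : Multiset A} {N : ℕ}
    (hN : Chains (rowWord T) σ N) : N ≤ topSize (Multiset.card σ) T := by
  classical
  rw [← map_fst_columnWord] at hN
  set C := (T.headD []).length with hC
  have hle : ∀ s ∈ T, s.length ≤ C := by
    cases T with
    | nil => simp
    | cons r T => exact fun s hs => h.length_le_head hs
  have hCv : ∀ p ∈ columnWord T, p.2 < C := by
    rintro ⟨b, j⟩ hb
    simp only [columnWord, List.mem_flatten, List.mem_reverse, List.mem_map] at hb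
    obtain ⟨_, ⟨r, hr, rfl⟩, hb⟩ := hb
    rw [List.mem_zipIdx_iff_getElem?] at hb
    exact (List.getElem?_eq_some_iff.1 hb).1.trans_le (hle r hr)
  refine (hN.le_columns h.pairwise_columnWord C hCv).trans ?_
  rw [topSize, ← sum_countP_length _ C fun s hs => hle s (List.mem_of_mem_take hs)]
  refine Finset.sum_le_sum fun c _ => ?_
  rw [← h.min_countP_columnWord]
  exact min_le_min le_rfl (Multiset.countP_le_card _ _)

/-! ### The top rows under prepending a letter -/

theorem topSize_insertionTableau_le_cons {a : A} (ha : ∀ b, a ≤ b) (k : ℕ) (x : A) (w : List A) :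
    topSize k (insertionTableau w) ≤ topSize k (insertionTableau (x :: w)) := by
  have h1 : Knuth (x :: w) (x :: rowWord (insertionTableau w)) :=
    (knuth_insertionTableau w).append_left [x]
  have h2 := chains_rowWord_append (isTableau_insertionTableau w).sorted ha k
    (v := []) (τ := 0) (N := 0) rfl
  simp only [List.append_nil, add_zero, zero_add] at h2
  have h3 := (knuth_insertionTableau (x :: w)).chains_iff _ _ |>.1
    ((h1.chains_iff _ _).2 (h2.skip (x := x)))
  simpa using (isTableau_insertionTableau (x :: w)).chains_le h3

/-- The sequence that reads row `m` may start with the new letter `x`, which is at most every letter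
of that row: one letter is gained. -/
theorem topSize_insertionTableau_lt_cons {a : A} (ha : ∀ b, a ≤ b) {k m : ℕ} (hm : m < k) {x : A}
    {w : List A} (hx : ∀ b ∈ (insertionTableau w).getD m [], x ≤ b) :
    topSize k (insertionTableau w) < topSize k (insertionTableau (x :: w)) := by
  have h1 : Knuth (x :: w) (x :: rowWord (insertionTableau w)) :=
    (knuth_insertionTableau w).append_left [x]
  have h2 := chains_cons_rowWord_append (isTableau_insertionTableau w).sorted ha hm hx
    (v := []) (τ := 0) (N := 0) rfl
  simp only [List.append_nil, add_zero, zero_add] at h2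
  have h3 := (knuth_insertionTableau (x :: w)).chains_iff _ _ |>.1
    ((h1.chains_iff _ _).2 (Chains.take ⟨a, _, rfl, ha x, rfl⟩ h2))
  have h4 := (isTableau_insertionTableau (x :: w)).chains_le h3
  rw [Multiset.card_cons, Multiset.card_replicate, Nat.sub_add_cancel (by omega)] at h4
  exact h4

end Chains

/-! ### The off-diagonal part of a tableau as a system of queues -/

section Queues

variable {d : ℕ}

/-- The queue at `(i, j)`, `i < j`, holds the letters `j` in row `i`.  A token `j` joins the queue and
becomes the idle token `i`; an idle token `i` releases a letter `j`, if there is one. -/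
def cellMove (i j : Fin d) (p : (Fin d × Fin d → ℕ) × Fin d) : (Fin d × Fin d → ℕ) × Fin d :=
  if p.2 = j then (Function.update p.1 (i, j) (p.1 (i, j) + 1), i)
  else if p.2 = i ∧ 0 < p.1 (i, j) then (Function.update p.1 (i, j) (p.1 (i, j) - 1), j)
  else p

/-- The passage of a token through the queues `(i, j)` for `j` in a list. -/
def cellsPass (i : Fin d) (l : List (Fin d)) (p : (Fin d × Fin d → ℕ) × Fin d) :
    (Fin d × Fin d → ℕ) × Fin d :=
  l.foldl (fun p j => cellMove i j p) p

/-- The passage of a token through row `i`. -/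
def rowPass (i : Fin d) (p : (Fin d × Fin d → ℕ) × Fin d) : (Fin d × Fin d → ℕ) × Fin d :=
  cellsPass i ((List.finRange d).filter (i < ·)) p

/-- The passage of a token through the rows in a list. -/
def rowsPass (l : List (Fin d)) (p : (Fin d × Fin d → ℕ) × Fin d) :
    (Fin d × Fin d → ℕ) × Fin d :=
  l.foldl (fun p i => rowPass i p) p

/-- The insertion of a letter. -/
def queueInsert (s : Fin d × Fin d → ℕ) (x : Fin d) : Fin d × Fin d → ℕ :=
  (rowsPass (List.finRange d) (s, x)).1

theorem cellMove_join (i j : Fin d) (s : Fin d × Fin d → ℕ) :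
    cellMove i j (s, j) = (Function.update s (i, j) (s (i, j) + 1), i) := by
  simp [cellMove]

/-- A join leaves a nonempty queue and the token `i`, which is where a release undoes it, and
conversely; all other pairs are fixed. -/
theorem cellMove_involutive {i j : Fin d} (hij : i ≠ j) : Function.Involutive (cellMove i j) := by
  rintro ⟨s, t⟩
  by_cases hj : t = j
  · subst hj
    simp [cellMove, hij]
  · by_cases hi : t = i ∧ 0 < s (i, j)
    · obtain ⟨rfl, hp⟩ := hi
      have h1 : cellMove t j (s, t) = (Function.update s (t, j) (s (t, j) - 1), j) := by
        simp [cellMove, hij, hp]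
      have h2 : s (t, j) - 1 + 1 = s (t, j) := by omega
      rw [h1, cellMove_join]
      simp [h2]
    · have h1 : cellMove i j (s, t) = (s, t) := by
        simp only [cellMove, hj, hi, if_false]
      rw [h1, h1]

theorem cellMove_of_ne {i j t : Fin d} (s : Fin d × Fin d → ℕ) (hi : t ≠ i) (hj : t ≠ j) :
    cellMove i j (s, t) = (s, t) := by
  simp [cellMove, hi, hj]

theorem cellMove_apply_of_ne (i j : Fin d) (p : (Fin d × Fin d → ℕ) × Fin d) {q : Fin d × Fin d}
    (hq : q ≠ (i, j)) : (cellMove i j p).1 q = p.1 q := by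
  unfold cellMove
  split_ifs <;> simp [hq]

theorem cellsPass_of_ne {i t : Fin d} {l : List (Fin d)} (s : Fin d × Fin d → ℕ) (hi : t ≠ i)
    (hl : t ∉ l) : cellsPass i l (s, t) = (s, t) := by
  induction l with
  | nil => rfl
  | cons a l ih =>
    simp only [List.mem_cons, not_or] at hl
    rw [cellsPass, List.foldl_cons, cellMove_of_ne s hi hl.1]
    exact ih hl.2

theorem cellsPass_apply_of_ne (i : Fin d) (l : List (Fin d)) (p : (Fin d × Fin d → ℕ) × Fin d)
    {q : Fin d × Fin d} (hq : q.1 = i → q.2 ∉ l) : (cellsPass i l p).1 q = p.1 q := by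
  induction l generalizing p with
  | nil => rfl
  | cons a l ih =>
    rw [cellsPass, List.foldl_cons]
    refine (ih _ fun h => ?_).trans (cellMove_apply_of_ne i a p ?_)
    · exact fun h' => hq h (List.mem_cons_of_mem _ h')
    · rintro rfl
      exact hq rfl List.mem_cons_self

theorem rowPass_apply_of_ne (i : Fin d) (p : (Fin d × Fin d → ℕ) × Fin d)
    {q : Fin d × Fin d} (hq : q.1 = i → q.2 ≤ q.1) : (rowPass i p).1 q = p.1 q :=
  cellsPass_apply_of_ne i _ p fun h => by simpa [← h] using hq h

theorem rowsPass_apply_of_notMem (l : List (Fin d)) (p : (Fin d × Fin d → ℕ) × Fin d)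
    {q : Fin d × Fin d} (hq : q.1 ∈ l → q.2 ≤ q.1) : (rowsPass l p).1 q = p.1 q := by
  induction l generalizing p with
  | nil => rfl
  | cons a l ih =>
    rw [rowsPass, List.foldl_cons]
    refine (ih _ fun h => hq (List.mem_cons_of_mem _ h)).trans (rowPass_apply_of_ne a p fun h => ?_)
    exact hq (h ▸ List.mem_cons_self)

theorem cellsPass_idle {i : Fin d} {l : List (Fin d)} (hl : l.Pairwise (· < ·))
    (hi : ∀ j ∈ l, i < j) (s : Fin d × Fin d → ℕ) :
    ((∀ j ∈ l, s (i, j) = 0) ∧ cellsPass i l (s, i) = (s, i)) ∨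
      ∃ b ∈ l, 0 < s (i, b) ∧ (∀ j ∈ l, j < b → s (i, j) = 0) ∧
        cellsPass i l (s, i) = (Function.update s (i, b) (s (i, b) - 1), b) := by
  induction l with
  | nil => exact Or.inl ⟨by simp, rfl⟩
  | cons a l ih =>
    rw [List.pairwise_cons] at hl
    have hia : i ≠ a := (hi a List.mem_cons_self).ne
    rw [cellsPass, List.foldl_cons]
    by_cases h0 : s (i, a) = 0
    · have h1 : cellMove i a (s, i) = (s, i) := by simp [cellMove, hia, h0]
      rw [h1]
      rcases ih hl.2 fun j hj => hi j (List.mem_cons_of_mem _ hj) with ⟨h, h'⟩ | ⟨b, hb, hp, h, h'⟩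
      · exact Or.inl ⟨by simpa using ⟨h0, h⟩, h'⟩
      · exact Or.inr ⟨b, List.mem_cons_of_mem _ hb, hp, by simpa using ⟨fun _ => h0, h⟩, h'⟩
    · have h1 : cellMove i a (s, i) = (Function.update s (i, a) (s (i, a) - 1), a) := by
        simp [cellMove, hia, Nat.pos_of_ne_zero h0]
      rw [h1]
      refine Or.inr ⟨a, List.mem_cons_self, Nat.pos_of_ne_zero h0, ?_, ?_⟩
      · simpa using fun j hj hja => absurd hja (hl.1 j hj).not_gt
      · exact cellsPass_of_ne _ hia.symm fun h => (hl.1 a h).false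

theorem cellsPass_join {i y : Fin d} {l : List (Fin d)} (hl : l.Pairwise (· < ·)) (hy : y ∈ l)
    (hiy : i ≠ y) (s : Fin d × Fin d → ℕ) : cellsPass i l (s, y) =
      cellsPass i (l.filter (y < ·)) (Function.update s (i, y) (s (i, y) + 1), i) := by
  induction l with
  | nil => simp at hy
  | cons a l ih =>
    rw [List.pairwise_cons] at hl
    rw [cellsPass, List.foldl_cons]
    rcases List.mem_cons.1 hy with rfl | hy
    · rw [cellMove_join]
      have h1 : (y :: l).filter (y < ·) = l := by
        rw [List.filter_cons_of_neg (by simp), List.filter_eq_self]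
        simpa using hl.1
      rw [h1]; rfl
    · have hay : a < y := hl.1 y hy
      rw [cellMove_of_ne s hiy.symm hay.ne', List.filter_cons_of_neg (by simpa using hay.le)]
      exact ih hl.2 hy

/-- Letters `i` in row `i` are not recorded, so the token `y = i` joins no queue. In both cases the
token is then idle and only the queues beyond `y` can still act. -/
theorem rowPass_eq {i y : Fin d} (hiy : i ≤ y) (s : Fin d × Fin d → ℕ) :
    rowPass i (s, y) = cellsPass i ((List.finRange d).filter (y < ·))
      (if y = i then s else Function.update s (i, y) (s (i, y) + 1), i) := by
  split_ifs with h
  · subst h; rfl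
  · have h1 : i < y := lt_of_le_of_ne hiy (Ne.symm h)
    rw [rowPass, cellsPass_join ((List.pairwise_lt_finRange d).filter _) (by simpa using h1) h1.ne,
      List.filter_filter]
    congr 1
    refine List.filter_congr fun j _ => ?_
    simpa using h1.trans

/-- A token at least `i` passes through row `i`: either all queues beyond it are empty and it leaves
idle, or it releases the smallest possible letter. -/
theorem rowPass_cases {i y : Fin d} (hiy : i ≤ y) (s : Fin d × Fin d → ℕ) :
    ((∀ j, y < j → s (i, j) = 0) ∧
      rowPass i (s, y) = (if y = i then s else Function.update s (i, y) (s (i, y) + 1), i)) ∨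
    ∃ b, y < b ∧ 0 < s (i, b) ∧ (∀ j, y < j → j < b → s (i, j) = 0) ∧
      rowPass i (s, y) = (Function.update
        (if y = i then s else Function.update s (i, y) (s (i, y) + 1)) (i, b) (s (i, b) - 1), b) := by
  set s' := if y = i then s else Function.update s (i, y) (s (i, y) + 1) with hs'
  have hval : ∀ j, y < j → s' (i, j) = s (i, j) := by
    intro j hj
    rw [hs']
    split_ifs
    · rfl
    · simp [hj.ne']
  rw [rowPass_eq hiy]
  rcases cellsPass_idle (l := (List.finRange d).filter (y < ·))
    ((List.pairwise_lt_finRange d).filter _) (fun j hj => hiy.trans_lt (by simpa using hj)) s' with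
    ⟨h, h'⟩ | ⟨b, hb, hp, h, h'⟩
  · refine Or.inl ⟨fun j hj => ?_, h'⟩
    rw [← hval j hj]
    exact h j (by simpa using hj)
  · have hb : y < b := by simpa using hb
    rw [hval b hb] at hp h'
    refine Or.inr ⟨b, hb, hp, fun j hj hjb => ?_, h'⟩
    rw [← hval j hj]
    exact h j (by simpa using hj) hjb

/-- This is how an insertion stops: once a row absorbs the letter without bumping, the token is the
index of that row and is inert in all later rows. -/
theorem rowsPass_of_lt {t : Fin d} {l : List (Fin d)} (hl : ∀ i ∈ l, t < i)
    (s : Fin d × Fin d → ℕ) : rowsPass l (s, t) = (s, t) := by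
  induction l with
  | nil => rfl
  | cons a l ih =>
    have ha := hl a List.mem_cons_self
    rw [rowsPass, List.foldl_cons]
    have : rowPass a (s, t) = (s, t) :=
      cellsPass_of_ne s ha.ne fun h => by
        have h' : a < t := by simpa using h
        exact h'.not_gt ha
    rw [this]
    exact ih fun i hi => hl i (List.mem_cons_of_mem _ hi)

theorem drop_finRange {m : ℕ} (hm : m < d) :
    (List.finRange d).drop m = ⟨m, hm⟩ :: (List.finRange d).drop (m + 1) := by
  rw [List.drop_eq_getElem_cons (by simpa using hm)]
  simp

theorem le_of_mem_drop_finRange {m : ℕ} {i : Fin d} (hi : i ∈ (List.finRange d).drop m) :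
    m ≤ (i : ℕ) := by
  obtain ⟨n, hn, rfl⟩ := List.mem_iff_getElem.1 hi
  simp

theorem rowsPass_drop {m : ℕ} (hm : m < d) (p : (Fin d × Fin d → ℕ) × Fin d) :
    rowsPass ((List.finRange d).drop m) p =
      rowsPass ((List.finRange d).drop (m + 1)) (rowPass ⟨m, hm⟩ p) := by
  rw [drop_finRange hm]; rfl

/-! ### Row insertion in terms of the queues -/

theorem getD_tableauInsert_zero {A : Type*} [LinearOrder A] (T : List (List A)) (x : A) :
    (tableauInsert T x).getD 0 [] = (rowInsert x (T.getD 0 [])).1 := by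
  cases T with
  | nil => simp [tableauInsert, rowInsert]
  | cons r T => cases h : (rowInsert x r).2 with
    | none => simp [tableauInsert_cons_none T h]
    | some y => simp [tableauInsert_cons_some T h]

theorem getD_tableauInsert_succ_none {A : Type*} [LinearOrder A] {T : List (List A)} {x : A}
    (h : (rowInsert x (T.getD 0 [])).2 = none) (n : ℕ) :
    (tableauInsert T x).getD (n + 1) [] = T.getD (n + 1) [] := by
  cases T with
  | nil => simp [tableauInsert]
  | cons r T => simp [tableauInsert_cons_none T (by simpa using h)]

theorem getD_tableauInsert_succ_some {A : Type*} [LinearOrder A] {T : List (List A)} {x y : A}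
    (h : (rowInsert x (T.getD 0 [])).2 = some y) (n : ℕ) :
    (tableauInsert T x).getD (n + 1) [] = (tableauInsert T.tail y).getD n [] := by
  cases T with
  | nil => simp [rowInsert] at h
  | cons r T => simp [tableauInsert_cons_some T (by simpa using h)]

theorem getD_tail {A : Type*} (T : List (List A)) (n : ℕ) :
    T.tail.getD n [] = T.getD (n + 1) [] := by
  cases T <;> simp

/-- The offset `m` is the index of the first row of `T` within a larger tableau; a bumped letter
exceeds the one that bumps it, so it has the right to enter the next row. -/
theorem le_of_mem_tableauInsert {m : ℕ} {T : List (List (Fin d))}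
    (hT : ∀ n, ∀ b ∈ T.getD n [], m + n ≤ (b : ℕ)) {x : Fin d} (hx : m ≤ (x : ℕ)) (n : ℕ) :
    ∀ b ∈ (tableauInsert T x).getD n [], m + n ≤ (b : ℕ) := by
  induction n generalizing m T x with
  | zero =>
    rw [getD_tableauInsert_zero]
    intro b hb
    rcases mem_of_mem_rowInsert hb with rfl | hb
    · simpa using hx
    · exact hT 0 b hb
  | succ n ih =>
    cases h : (rowInsert x (T.getD 0 [])).2 with
    | none => rw [getD_tableauInsert_succ_none h]; exact hT (n + 1)
    | some y =>
      rw [getD_tableauInsert_succ_some h]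
      have hxy : (x : ℕ) < y := Fin.lt_def.1 (rowInsert_bump_gt h)
      intro b hb
      have := ih (m := m + 1) (T := T.tail) (x := y)
        (fun n b hb => by rw [getD_tail] at hb; have := hT (n + 1) b hb; omega) (by omega) b hb
      omega

/-- Row insertion into one row agrees with the passage through the queues of that row. -/
theorem rowPass_rowInsert {i x : Fin d} (hix : i ≤ x) {r : List (Fin d)}
    (hr : r.Pairwise (· ≤ ·)) {s : Fin d × Fin d → ℕ} (hs : ∀ j, i < j → s (i, j) = r.count j) :
    (rowPass i (s, x)).2 = (rowInsert x r).2.getD i ∧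
      ∀ j, i < j → (rowPass i (s, x)).1 (i, j) = (rowInsert x r).1.count j := by
  have hperm := rowInsert_perm x r
  rcases rowPass_cases hix s with ⟨h0, h⟩ | ⟨b, hxb, hb, h0, h⟩
  · have hnone : (rowInsert x r).2 = none := by
      rw [Option.eq_none_iff_forall_ne_some]
      intro b hb
      have hxb := rowInsert_bump_gt hb
      have h1 := h0 b hxb
      rw [hs b (hix.trans_lt hxb), List.count_eq_zero] at h1
      exact h1 (rowInsert_bump_mem hb)
    rw [hnone] at hperm
    rw [h, hnone]
    refine ⟨rfl, fun j hj => ?_⟩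
    rw [show (rowInsert x r).1.count j = _ from hperm.count_eq j, List.count_cons]
    by_cases hx : x = i
    · have : ¬ x = j := by rw [hx]; exact hj.ne
      simp [hx, hj.ne, hs j hj]
    · by_cases hxj : x = j
      · subst hxj; simp [hx, hs x hj]
      · simp [hx, hxj, Ne.symm hxj, hs j hj]
  · have hib := hix.trans_lt hxb
    have hsome : (rowInsert x r).2 = some b := by
      rw [hs b hib, List.count_pos_iff] at hb
      cases hc : (rowInsert x r).2 with
      | none => exact absurd (rowInsert_bump_none hc b hb) hxb.not_ge
      | some c =>
        have hxc := rowInsert_bump_gt hc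
        rcases (rowInsert_bump_min hr hc b hb hxb).lt_or_eq with hcb | rfl
        · have h1 := h0 c hxc hcb
          rw [hs c (hix.trans_lt hxc), List.count_eq_zero] at h1
          exact absurd (rowInsert_bump_mem hc) h1
        · rfl
    rw [hsome] at hperm
    rw [h, hsome]
    refine ⟨rfl, fun j hj => ?_⟩
    have h2 : (b :: (rowInsert x r).1).count j = _ := hperm.count_eq j
    rw [List.count_cons, List.count_cons] at h2
    by_cases hbj : b = j
    · subst hbj
      have h3 := hs b hib
      simp [hxb.ne] at h2
      simp
      omega
    · by_cases hx : x = i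
      · have : ¬ x = j := by rw [hx]; exact hj.ne
        simp [this, hbj] at h2
        rw [if_pos hx]
        simp [Ne.symm hbj, hs j hj, h2]
      · by_cases hxj : x = j
        · subst hxj
          simp [hbj] at h2
          simp [hx, Ne.symm hbj, hs x hj, h2]
        · simp [hxj, hbj] at h2
          simp [hx, Ne.symm hbj, Ne.symm hxj, hs j hj, h2]

/-- Generalised by the offset `m`, so that the induction can pass from `T` to its tail. -/
theorem rowsPass_tableauInsert {m : ℕ} {T : List (List (Fin d))}
    (hT : ∀ n, (T.getD n []).Pairwise (· ≤ ·)) {x : Fin d} (hx : m ≤ (x : ℕ))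
    {s : Fin d × Fin d → ℕ}
    (hs : ∀ i j : Fin d, m ≤ (i : ℕ) → i < j → s (i, j) = (T.getD (i - m) []).count j)
    (i j : Fin d) (hi : m ≤ (i : ℕ)) (hij : i < j) :
    (rowsPass ((List.finRange d).drop m) (s, x)).1 (i, j) =
      ((tableauInsert T x).getD (i - m) []).count j := by
  have hm : m < d := hi.trans_lt i.2
  induction hn : (i : ℕ) - m generalizing m T x s with
  | zero =>
    have him : i = ⟨m, hm⟩ := Fin.ext (by simp; omega)
    rw [rowsPass_drop hm, rowsPass_apply_of_notMem, ← him, getD_tableauInsert_zero]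
    · refine (rowPass_rowInsert (r := T.getD 0 []) ?_ (hT 0) fun j hj => ?_).2 j hij
      · rw [him]; exact hx
      · rw [hs i j hi hj, hn]
    · intro h
      have := le_of_mem_drop_finRange h
      simp only at this
      omega
  | succ n ih =>
    set i₀ : Fin d := ⟨m, hm⟩ with hi₀
    obtain ⟨h1, h2⟩ := rowPass_rowInsert (i := i₀) (x := x) (r := T.getD 0 []) hx (hT 0)
      (s := s) fun j hj => by simpa [hi₀] using hs i₀ j le_rfl hj
    have h3 : ∀ a b : Fin d, m < (a : ℕ) → (rowPass i₀ (s, x)).1 (a, b) = s (a, b) :=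
      fun a b ha => rowPass_apply_of_ne _ _ fun h => by
        simp only at h
        rw [h] at ha
        simp [hi₀] at ha
    rw [rowsPass_drop hm]
    cases hc : (rowInsert x (T.getD 0 [])).2 with
    | none =>
      rw [hc] at h1
      have h4 : rowPass ⟨m, hm⟩ (s, x) = ((rowPass i₀ (s, x)).1, i₀) := Prod.ext rfl h1
      rw [h4, rowsPass_of_lt, getD_tableauInsert_succ_none hc]
      · simp only
        rw [h3 i j (by omega), hs i j hi hij, hn]
      · intro a ha
        have := le_of_mem_drop_finRange ha
        exact Fin.lt_def.2 (by simp [hi₀]; omega)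
    | some y =>
      rw [hc] at h1
      have hxy : (x : ℕ) < y := Fin.lt_def.1 (rowInsert_bump_gt hc)
      have h4 : rowPass ⟨m, hm⟩ (s, x) = ((rowPass i₀ (s, x)).1, y) := Prod.ext rfl h1
      rw [h4, getD_tableauInsert_succ_some hc]
      refine ih (m := m + 1) (T := T.tail) (fun n => by rw [getD_tail]; exact hT _) (by omega)
        (fun a b ha hab => ?_) (by omega) (by omega) (by omega)
      rw [h3 a b (by omega), hs a b (by omega) hab, getD_tail]
      congr 2
      omega

/-- The state of the queues after the insertion of a word. -/
def queueRun (s : Fin d × Fin d → ℕ) (w : List (Fin d)) : Fin d × Fin d → ℕ :=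
  w.foldl queueInsert s

theorem queueRun_append (s : Fin d × Fin d → ℕ) (u v : List (Fin d)) :
    queueRun s (u ++ v) = queueRun (queueRun s u) v := List.foldl_append

theorem IsTableau.getD_sorted {A : Type*} [LinearOrder A] {T : List (List A)} (h : IsTableau T)
    (n : ℕ) : (T.getD n []).Pairwise (· ≤ ·) := by
  by_cases hn : n < T.length
  · rw [List.getD_eq_getElem _ _ hn]
    exact h.sorted _ (List.getElem_mem hn)
  · rw [List.getD_eq_default _ _ (not_lt.1 hn)]
    exact List.Pairwise.nil

theorem queueRun_zero_eq_count (w : List (Fin d)) (i j : Fin d) (hij : i < j) :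
    queueRun 0 w (i, j) = ((insertionTableau w).getD i []).count j := by
  induction w using List.reverseRecOn generalizing i j with
  | nil => simp [queueRun, insertionTableau]
  | append_singleton w x ih =>
    rw [queueRun_append, insertionTableau_append_singleton]
    change (rowsPass (List.finRange d) (queueRun 0 w, x)).1 (i, j) = _
    simpa using rowsPass_tableauInsert (m := 0)
      (isTableau_insertionTableau w).getD_sorted (Nat.zero_le x)
      (fun i j _ hij => by simpa using ih i j hij) i j (Nat.zero_le _) hij

theorem le_of_mem_insertionTableau (w : List (Fin d)) (n : ℕ) :
    ∀ b ∈ (insertionTableau w).getD n [], n ≤ (b : ℕ) := by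
  induction w using List.reverseRecOn generalizing n with
  | nil => simp [insertionTableau]
  | append_singleton w x ih =>
    rw [insertionTableau_append_singleton]
    simpa using le_of_mem_tableauInsert (m := 0) (fun n => by simpa using ih n) (Nat.zero_le x) n

end Queues

/-! ### The number of large letters in the first rows -/

section Large

variable {d : ℕ}

theorem flatten_tableauInsert_perm {A : Type*} [LinearOrder A] (T : List (List A)) (x : A) :
    (tableauInsert T x).flatten.Perm (x :: T.flatten) := by
  induction T generalizing x with
  | nil => simp [tableauInsert]
  | cons r T ih =>
    have h := (rowInsert_perm x r).append_right T.flatten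
    cases hy : (rowInsert x r).2 with
    | none =>
      rw [hy] at h
      simpa [tableauInsert_cons_none T hy] using h
    | some y =>
      rw [hy] at h
      rw [tableauInsert_cons_some T hy, List.flatten_cons, List.flatten_cons]
      refine ((ih y).append_left _).trans (List.perm_middle.trans ?_)
      simpa using h

theorem flatten_insertionTableau_perm {A : Type*} [LinearOrder A] (w : List A) :
    (insertionTableau w).flatten.Perm w := by
  induction w using List.reverseRecOn with
  | nil => simp [insertionTableau]
  | append_singleton w x ih =>
    rw [insertionTableau_append_singleton]
    exact (flatten_tableauInsert_perm _ x).trans ((ih.cons x).trans (List.perm_append_singleton x w).symm)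

theorem sum_map_take {A : Type*} (f : List A → ℕ) (hf : f [] = 0) (T : List (List A)) (k : ℕ) :
    ((T.take k).map f).sum = ∑ i ∈ Finset.range k, f (T.getD i []) := by
  induction T generalizing k with
  | nil => simp [hf]
  | cons r T ih => cases k with
    | zero => simp
    | succ k =>
      rw [Finset.sum_range_succ', List.take_succ_cons, List.map_cons, List.sum_cons, ih k, add_comm]
      simp

theorem sum_Iic_eq_sum_range (k : Fin d) (g : ℕ → ℕ) :
    ∑ i ∈ Finset.Iic k, g i = ∑ i ∈ Finset.range (k + 1), g i := by
  rw [Nat.range_succ_eq_Iic, ← Fin.map_valEmbedding_Iic, Finset.sum_map]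
  rfl

theorem topSize_eq_sum (k : Fin d) {A : Type*} (T : List (List A)) :
    topSize (k + 1) T = ∑ i ∈ Finset.Iic k, (T.getD i []).length := by
  rw [sum_Iic_eq_sum_range k fun i => (T.getD i []).length]
  exact sum_map_take _ rfl T _

theorem countP_gt_eq_sum (k : Fin d) (r : List (Fin d)) :
    r.countP (k < ·) = ∑ j ∈ Finset.Ioi k, r.count j := by
  induction r with
  | nil => simp
  | cons a r ih =>
    simp only [List.countP_cons, List.count_cons, Finset.sum_add_distrib, ih]
    simp

/-- The number of letters larger than `k` in the rows up to `k`. -/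
def largeCount (k : Fin d) (s : Fin d × Fin d → ℕ) : ℕ :=
  ∑ i ∈ Finset.Iic k, ∑ j ∈ Finset.Ioi k, s (i, j)

/-- Rows after row `k` contain only letters larger than `k`, so every letter `≤ k` of the word is
among the cells counted on the left. -/
theorem topSize_insertionTableau_eq (k : Fin d) (w : List (Fin d)) :
    topSize (k + 1) (insertionTableau w) = largeCount k (queueRun 0 w) + w.countP (· ≤ k) := by
  have h1 : w.countP (· ≤ k) =
      ∑ i ∈ Finset.Iic k, ((insertionTableau w).getD i []).countP (· ≤ k) := by
    rw [sum_Iic_eq_sum_range k fun i => ((insertionTableau w).getD i []).countP (· ≤ k),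
      ← sum_map_take _ rfl, ← (flatten_insertionTableau_perm w).countP_eq]
    conv_lhs => rw [← List.take_append_drop (k + 1) (insertionTableau w)]
    rw [List.flatten_append, List.countP_append, List.countP_flatten]
    simp only [Nat.add_eq_left]
    rw [List.countP_eq_zero]
    intro b hb
    obtain ⟨r, hr, hbr⟩ := List.mem_flatten.1 hb
    obtain ⟨n, hn, rfl⟩ := List.mem_iff_getElem.1 hr
    rw [List.getElem_drop] at hbr
    have := le_of_mem_insertionTableau w (k + 1 + n) b
      (by rwa [List.getD_eq_getElem])
    simp only [decide_eq_true_eq, Fin.le_def]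
    omega
  rw [topSize_eq_sum, h1, largeCount, ← Finset.sum_add_distrib]
  refine Finset.sum_congr rfl fun i hi => ?_
  have hi : i ≤ k := Finset.mem_Iic.1 hi
  rw [List.length_eq_countP_add_countP (fun j => decide (k < j)), countP_gt_eq_sum]
  congr 1
  · refine Finset.sum_congr rfl fun j hj => ?_
    rw [queueRun_zero_eq_count w i j (hi.trans_lt (Finset.mem_Ioi.1 hj))]
  · exact List.countP_congr fun j _ => by simp

/-- For `x ≤ k` the count of small letters grows by one and the top rows grow by at least one,
because row `x` has only letters `≥ x`. For `x > k` the first count is unchanged and the top rows do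
not shrink. -/
theorem largeCount_le_cons (k x : Fin d) (w : List (Fin d)) :
    largeCount k (queueRun 0 w) ≤ largeCount k (queueRun 0 (x :: w)) := by
  have ha : ∀ b : Fin d, (⟨0, k.pos⟩ : Fin d) ≤ b := fun b => Fin.le_def.2 (Nat.zero_le _)
  have h1 := topSize_insertionTableau_eq k w
  have h2 := topSize_insertionTableau_eq k (x :: w)
  rw [List.countP_cons] at h2
  by_cases hx : x ≤ k
  · have h3 := topSize_insertionTableau_lt_cons ha (k := k + 1) (m := x)
      (Nat.lt_succ_of_le hx) (le_of_mem_insertionTableau w x)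
    simp [hx] at h2
    omega
  · have h3 := topSize_insertionTableau_le_cons ha (k + 1) x w
    simp [hx] at h2
    omega

end Large

/-! ### Words that empty the queues -/

section Reset

variable {d : ℕ}

theorem queueRun_apply_of_le (s : Fin d × Fin d → ℕ) (w : List (Fin d)) {q : Fin d × Fin d}
    (hq : q.2 ≤ q.1) : queueRun s w q = s q := by
  induction w generalizing s with
  | nil => rfl
  | cons x w ih => exact (ih _).trans (rowsPass_apply_of_notMem _ _ fun _ => hq)

/-- When the rows before row `m` are empty, a letter can be inserted directly into row `m`. -/
theorem exists_word_rowsPass (m : ℕ) (y : Fin d) (hy : m ≤ (y : ℕ)) :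
    ∃ u : List (Fin d), (∀ z ∈ u, z ≤ y) ∧ ∀ s : Fin d × Fin d → ℕ,
      (∀ q : Fin d × Fin d, (q.1 : ℕ) < m → s q = 0) →
        queueRun s u = (rowsPass ((List.finRange d).drop m) (s, y)).1 := by
  induction m generalizing y with
  | zero => exact ⟨[y], by simp, fun s _ => rfl⟩
  | succ m ih =>
    have hm : m < d := hy.trans_lt y.2 |>.le
    set i : Fin d := ⟨m, hm⟩ with hi
    have hiy : i < y := Fin.lt_def.2 hy
    -- The word `u` places `y` in the empty row `m`; then `v` brings the letter `m` to that row,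
    -- which bumps `y` on to row `m + 1`.
    obtain ⟨u, hu, hus⟩ := ih y (by omega)
    obtain ⟨v, hv, hvs⟩ := ih i le_rfl
    have hlt : ∀ a ∈ (List.finRange d).drop (m + 1), i < a := fun a ha =>
      Fin.lt_def.2 (le_of_mem_drop_finRange ha)
    refine ⟨u ++ v, ?_, fun s hs => ?_⟩
    · intro z hz
      rcases List.mem_append.1 hz with h | h
      · exact hu z h
      · exact (hv z h).trans hiy.le
    have hrow : ∀ j, s (i, j) = 0 := fun j => hs _ (Nat.lt_succ_self m)
    have h1 : queueRun s u = Function.update s (i, y) 1 := by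
      rw [hus s fun q hq => hs q (by omega), rowsPass_drop hm]
      rcases rowPass_cases hiy.le s with ⟨-, h⟩ | ⟨b, -, hb, -⟩
      · rw [h, rowsPass_of_lt hlt]
        simp [hiy.ne', hrow]
      · rw [hrow] at hb; exact absurd hb (lt_irrefl _)
    rw [queueRun_append, h1, hvs, rowsPass_drop hm]
    · rcases rowPass_cases (le_refl i) (Function.update s (i, y) 1) with ⟨h, -⟩ | ⟨b, hib, hb, -, h⟩
      · exact absurd (h y hiy) (by simp)
      · obtain rfl : b = y := by
          by_contra hne
          simp [hne, hrow] at hb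
        rw [h]
        congr 2
        have := hrow b
        simp [← this]
    · intro q hq
      rw [Function.update_of_ne, hs q (by omega)]
      rintro rfl
      simp [hi] at hq

theorem rowsPass_drop_zero {m : ℕ} (hm : m < d) :
    rowsPass ((List.finRange d).drop m) ((0 : Fin d × Fin d → ℕ), ⟨m, hm⟩) = (0, ⟨m, hm⟩) := by
  rw [rowsPass_drop hm]
  rcases rowPass_cases (le_refl (⟨m, hm⟩ : Fin d)) 0 with ⟨-, h⟩ | ⟨b, -, hb, -⟩
  · rw [h, rowsPass_of_lt]
    · simp
    · exact fun a ha => Fin.lt_def.2 (le_of_mem_drop_finRange ha)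
  · simp at hb

/-- Each letter `m` brought directly to row `m` releases one larger letter from it, so `N`
repetitions clear the row. -/
theorem exists_word_clear_row {m : ℕ} (hm : m + 1 < d) (N : ℕ) (s : Fin d × Fin d → ℕ)
    (hs : ∀ q : Fin d × Fin d, (q.1 : ℕ) < m → s q = 0)
    (hN : ∑ j ∈ Finset.Ioi (⟨m, by omega⟩ : Fin d), s (⟨m, by omega⟩, j) = N) :
    ∃ u : List (Fin d), (∀ z ∈ u, (z : ℕ) + 1 < d) ∧ queueRun 0 u = 0 ∧
      (∀ q : Fin d × Fin d, (q.1 : ℕ) < m → queueRun s u q = 0) ∧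
      ∀ j : Fin d, m < (j : ℕ) → queueRun s u (⟨m, by omega⟩, j) = 0 := by
  have hm' : m < d := by omega
  set i : Fin d := ⟨m, hm'⟩ with hi
  induction N generalizing s with
  | zero =>
    refine ⟨[], by simp, rfl, hs, fun j hj => ?_⟩
    exact Finset.sum_eq_zero_iff.1 hN j (Finset.mem_Ioi.2 (Fin.lt_def.2 hj))
  | succ N ih =>
    obtain ⟨v, hv, hvs⟩ := exists_word_rowsPass m i le_rfl
    have h1 := hvs s hs
    rw [rowsPass_drop hm'] at h1
    have h2 : ∀ q : Fin d × Fin d, (q.1 : ℕ) ≤ m → queueRun s v q = (rowPass i (s, i)).1 q := by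
      intro q hq
      rw [h1]
      refine rowsPass_apply_of_notMem _ _ fun h => ?_
      have := le_of_mem_drop_finRange h
      omega
    rcases rowPass_cases (le_refl i) s with ⟨h, -⟩ | ⟨b, hib, hb, -, h⟩
    · rw [Finset.sum_eq_zero fun j hj => h j (Finset.mem_Ioi.1 hj)] at hN
      omega
    · have h3 : ∀ q : Fin d × Fin d, (q.1 : ℕ) < m → queueRun s v q = 0 := by
        intro q hq
        rw [h2 q hq.le, rowPass_apply_of_ne]
        · exact hs q hq
        · intro h
          simp [h, hi] at hq
      have h4 : ∑ j ∈ Finset.Ioi i, queueRun s v (i, j) = N := by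
        have hbm : b ∈ Finset.Ioi i := Finset.mem_Ioi.2 hib
        rw [← Finset.add_sum_erase _ _ hbm] at hN ⊢
        have h5 : ∀ j ∈ (Finset.Ioi i).erase b, queueRun s v (i, j) = s (i, j) := by
          intro j hj
          rw [h2 (i, j) le_rfl, h]
          simp [(Finset.mem_erase.1 hj).1]
        rw [Finset.sum_congr rfl h5, h2 (i, b) le_rfl, h]
        simp
        omega
      obtain ⟨u, hu, hu0, hu1, hu2⟩ := ih (queueRun s v) h3 h4
      refine ⟨v ++ u, ?_, ?_, ?_, ?_⟩
      · intro z hz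
        rcases List.mem_append.1 hz with h | h
        · have := Fin.le_def.1 (hv z h)
          simp [hi] at this
          omega
        · exact hu z h
      · rw [queueRun_append, hvs 0 (by simp), rowsPass_drop_zero hm', hu0]
      · simpa only [queueRun_append] using hu1
      · simpa only [queueRun_append] using hu2

/-- Rows are cleared in increasing order; the last row has no queue, so the last letter is never
needed. -/
theorem exists_word_reset (s : Fin d × Fin d → ℕ) (hs : ∀ q : Fin d × Fin d, q.2 ≤ q.1 → s q = 0) :
    ∃ u : List (Fin d), (∀ z ∈ u, (z : ℕ) + 1 < d) ∧ queueRun 0 u = 0 ∧ queueRun s u = 0 := by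
  have key : ∀ m : ℕ, ∃ u : List (Fin d), (∀ z ∈ u, (z : ℕ) + 1 < d) ∧ queueRun 0 u = 0 ∧
      ∀ q : Fin d × Fin d, (q.1 : ℕ) < m → queueRun s u q = 0 := by
    intro m
    induction m with
    | zero => exact ⟨[], by simp, rfl, by simp⟩
    | succ m ih =>
      obtain ⟨u, hu, hu0, hus⟩ := ih
      by_cases hm : m + 1 < d
      · obtain ⟨v, hv, hv0, hv1, hv2⟩ := exists_word_clear_row hm _ (queueRun s u) hus rfl
        refine ⟨u ++ v, ?_, by rw [queueRun_append, hu0, hv0], fun q hq => ?_⟩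
        · intro z hz
          rcases List.mem_append.1 hz with h | h
          · exact hu z h
          · exact hv z h
        · by_cases hq' : q.2 ≤ q.1
          · rw [queueRun_apply_of_le _ _ hq', hs q hq']
          · rw [queueRun_append]
            rcases Nat.lt_succ_iff_lt_or_eq.1 hq with h | h
            · exact hv1 q h
            · have : q = (⟨m, by omega⟩, q.2) := Prod.ext (Fin.ext h) rfl
              rw [this]
              exact hv2 q.2 (by have := Fin.lt_def.1 (not_le.1 hq'); omega)
      · refine ⟨u, hu, hu0, fun q hq => ?_⟩
        by_cases hq' : q.2 ≤ q.1
        · rw [queueRun_apply_of_le _ _ hq', hs q hq']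
        · have := Fin.lt_def.1 (not_le.1 hq')
          have := q.2.2
          exact hus q (by omega)
  obtain ⟨u, hu, hu0, hus⟩ := key d
  exact ⟨u, hu, hu0, funext fun q => hus q q.1.2⟩

/-- The reset words are concatenated. Each fixes the empty state, so states already emptied stay
empty. -/
theorem exists_word_reset_finset (F : Finset (Fin d × Fin d → ℕ))
    (hF : ∀ s ∈ F, ∀ q : Fin d × Fin d, q.2 ≤ q.1 → s q = 0) :
    ∃ u : List (Fin d), (∀ z ∈ u, (z : ℕ) + 1 < d) ∧ queueRun 0 u = 0 ∧
      ∀ s ∈ F, queueRun s u = 0 := by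
  classical
  induction F using Finset.induction_on with
  | empty => exact ⟨[], by simp, rfl, by simp⟩
  | insert s F _ ih =>
    obtain ⟨u, hu, hu0, huF⟩ := ih fun t ht => hF t (Finset.mem_insert_of_mem ht)
    obtain ⟨v, hv, hv0, hvs⟩ := exists_word_reset (queueRun s u) fun q hq => by
      rw [queueRun_apply_of_le _ _ hq, hF s (Finset.mem_insert_self _ _) q hq]
    refine ⟨u ++ v, ?_, by rw [queueRun_append, hu0, hv0], fun t ht => ?_⟩
    · intro z hz
      rcases List.mem_append.1 hz with h | h
      · exact hu z h
      · exact hv z h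
    · rw [queueRun_append]
      rcases Finset.mem_insert.1 ht with rfl | ht
      · exact hvs
      · rw [huF t ht, hv0]

end Reset

/-! ### Expectations over random words -/

section WordSum

open scoped ENNReal

variable {A : Type*} [Fintype A]

/-- The sum of `f w` over the words `w` of length `n`, each weighted by the product of the weights
of its letters. -/
def wordSum {R : Type*} [CommSemiring R] (a : A → R) : ℕ → (List A → R) → R
  | 0, f => f []
  | n + 1, f => ∑ x, a x * wordSum a n fun w => f (x :: w)

theorem wordSum_congr {R : Type*} [CommSemiring R] (a : A → R) {n : ℕ} {f g : List A → R}
    (h : ∀ w, w.length = n → f w = g w) : wordSum a n f = wordSum a n g := by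
  induction n generalizing f g with
  | zero => exact h [] rfl
  | succ n ih =>
    exact Finset.sum_congr rfl fun x _ => congrArg _ (ih fun w hw => h _ (by simp [hw]))

theorem wordSum_add {R : Type*} [CommSemiring R] (a : A → R) (n : ℕ) (f g : List A → R) :
    wordSum a n (fun w => f w + g w) = wordSum a n f + wordSum a n g := by
  induction n generalizing f g with
  | zero => rfl
  | succ n ih => simp only [wordSum, ih, mul_add, Finset.sum_add_distrib]

theorem wordSum_const_mul {R : Type*} [CommSemiring R] (a : A → R) (n : ℕ) (c : R)
    (f : List A → R) : wordSum a n (fun w => c * f w) = c * wordSum a n f := by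
  induction n generalizing f with
  | zero => rfl
  | succ n ih =>
    simp only [wordSum, ih, Finset.mul_sum]
    exact Finset.sum_congr rfl fun x _ => by ring

theorem wordSum_const {R : Type*} [CommSemiring R] {a : A → R} (ha : ∑ x, a x = 1) (n : ℕ)
    (c : R) : wordSum a n (fun _ => c) = c := by
  induction n with
  | zero => rfl
  | succ n ih => simp only [wordSum, ih, ← Finset.sum_mul, ha, one_mul]

theorem wordSum_append {R : Type*} [CommSemiring R] (a : A → R) (m n : ℕ) (f : List A → R) :
    wordSum a (m + n) f = wordSum a m fun u => wordSum a n fun v => f (u ++ v) := by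
  induction m generalizing f with
  | zero => rw [Nat.zero_add]; rfl
  | succ m ih =>
    rw [Nat.add_right_comm]
    simp only [wordSum, ih, List.cons_append]

theorem map_wordSum {R S : Type*} [CommSemiring R] [CommSemiring S] (φ : R →+* S) (a : A → R)
    (n : ℕ) (f : List A → R) :
    φ (wordSum a n f) = wordSum (fun x => φ (a x)) n fun w => φ (f w) := by
  induction n generalizing f with
  | zero => rfl
  | succ n ih => simp only [wordSum, map_sum, map_mul, ih]

theorem wordSum_mono (a : A → ℝ≥0∞) {n : ℕ} {f g : List A → ℝ≥0∞} (h : ∀ w, f w ≤ g w) :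
    wordSum a n f ≤ wordSum a n g := by
  induction n generalizing f g with
  | zero => exact h []
  | succ n ih => exact Finset.sum_le_sum fun x _ => by gcongr; exact ih fun w => h _

theorem prod_le_wordSum (a : A → ℝ≥0∞) (u : List A) (f : List A → ℝ≥0∞) (hf : 1 ≤ f u) :
    (u.map a).prod ≤ wordSum a u.length f := by
  induction u generalizing f with
  | nil => simpa [wordSum] using hf
  | cons x u ih =>
    rw [List.map_cons, List.prod_cons, List.length_cons, wordSum]
    refine le_trans ?_ (Finset.single_le_sum (fun _ _ => zero_le) (Finset.mem_univ x))
    gcongr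
    exact ih _ hf

/-! ### Convergence to the stationary law -/

variable {S : Type*}

open Classical in
/-- The probability that two runs along the same random word end in different states. -/
noncomputable def distinctProb (a : A → ℝ≥0∞) (step : S → A → S) (n : ℕ) (s s' : S) : ℝ≥0∞ :=
  wordSum a n fun w => if w.foldl step s = w.foldl step s' then 0 else 1

open Classical in
theorem distinctProb_add (a : A → ℝ≥0∞) (step : S → A → S) (m n : ℕ) (s s' : S) :
    distinctProb a step (m + n) s s' =
      wordSum a m fun u => distinctProb a step n (u.foldl step s) (u.foldl step s') := by
  simp only [distinctProb, wordSum_append, List.foldl_append]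

open Classical in
theorem distinctProb_le {a : A → ℝ≥0∞} (ha : ∑ x, a x = 1) (step : S → A → S) (n : ℕ) (s s' : S) :
    distinctProb a step n s s' ≤ if s = s' then 0 else 1 := by
  split_ifs with h
  · subst h
    simp only [distinctProb, if_true]
    rw [wordSum_const ha]
  · calc _ ≤ wordSum a n fun _ => 1 := wordSum_mono a fun w => by split_ifs <;> simp
      _ = 1 := wordSum_const ha n 1

open Classical in
-- Two different states of `F` merge whenever the next letters spell `u`; outside `F` merging is not
-- claimed, and the last terms pay for it.
theorem distinctProb_add_le {a : A → ℝ≥0∞} (ha : ∑ x, a x = 1) (step : S → A → S) {F : Finset S}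
    {u : List A} {z : S} (hu : ∀ s ∈ F, u.foldl step s = z) (s s' : S) :
    distinctProb a step u.length s s' + (u.map a).prod * (if s = s' then 0 else 1) ≤
      (if s = s' then 0 else 1) + (u.map a).prod *
        ((if s ∈ F then 0 else 1) + if s' ∈ F then 0 else 1) := by
  have h1 := distinctProb_le ha step u.length s s'
  by_cases h : s = s'
  · simp only [h, if_true] at h1 ⊢
    simp [nonpos_iff_eq_zero.1 h1]
  · simp only [h, if_false] at h1 ⊢
    by_cases hs : s ∈ F
    · by_cases hs' : s' ∈ F
      · simp only [hs, hs', if_true, mul_one, add_zero, mul_zero]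
        have h2 := prod_le_wordSum a u
          (fun w => if w.foldl step s = w.foldl step s' then 1 else 0) (by simp [hu s hs, hu s' hs'])
        refine (add_le_add_right h2 _).trans ?_
        rw [distinctProb, ← wordSum_add]
        refine (wordSum_mono (g := fun _ => 1) a fun w => ?_).trans (wordSum_const ha _ 1).le
        split_ifs <;> simp
      · simp only [hs, hs', if_true, if_false, zero_add]
        gcongr
    · simp only [hs, if_false]
      gcongr
      simp

/-- A probability vector `π` on the states that is invariant under the insertion of a random
letter. -/
structure IsStationaryLaw (a : A → ℝ≥0∞) (step : S → A → S) (π : S → ℝ≥0∞) : Prop where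
  sum_letters : ∑ x, a x = 1
  sum_states : ∑' s, π s = 1
  invariant : ∀ f : S → ℝ≥0∞, ∑' s, π s * ∑ x, a x * f (step s x) = ∑' s, π s * f s

variable {a : A → ℝ≥0∞} {step : S → A → S} {π : S → ℝ≥0∞}

theorem IsStationaryLaw.tsum_wordSum (h : IsStationaryLaw a step π) (n : ℕ) (f : S → ℝ≥0∞) :
    ∑' s, π s * wordSum a n (fun w => f (w.foldl step s)) = ∑' s, π s * f s := by
  induction n with
  | zero => rfl
  | succ n ih =>
    simp only [wordSum, List.foldl_cons]
    rw [h.invariant fun s => wordSum a n fun w => f (w.foldl step s)]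
    exact ih

theorem IsStationaryLaw.tsum_mul_const (h : IsStationaryLaw a step π) (c : ℝ≥0∞) :
    ∑' s, π s * c = c := by
  rw [ENNReal.tsum_mul_right, h.sum_states, one_mul]

open Classical in
/-- The mass of the complement of a finite set of charged states tends to zero. -/
theorem IsStationaryLaw.tendsto_compl (h : IsStationaryLaw a step π) :
    Tendsto (fun F : Finset S => ∑' s, π s * if s ∈ F.filter (π · ≠ 0) then 0 else 1) atTop
      (𝓝 0) := by
  convert ENNReal.tendsto_tsum_compl_atTop_zero (f := π) (by rw [h.sum_states]; simp) using 2
    with F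
  rw [show ∑' b : {x // x ∉ F}, π b = _ from tsum_subtype {s | s ∉ F} π]
  refine tsum_congr fun s => ?_
  by_cases hs : s ∈ F
  · by_cases h0 : π s = 0 <;> simp [hs, h0, Set.indicator]
  · simp [hs, Set.indicator]

open Classical in
-- The probability `q` of not having merged decreases to some `l`. With `δ` the probability of a
-- reset word for a finite set `G` and `κ` the stationary mass outside `G`, a limit in the merging
-- inequality gives `l ≤ κ + κ / π s₀`, and `κ` can be made arbitrarily small.
theorem IsStationaryLaw.tendsto_distinctProb (h : IsStationaryLaw a step π) {s₀ : S} (hs₀ : π s₀ ≠ 0)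
    (hreset : ∀ F : Finset S, (∀ s ∈ F, π s ≠ 0) →
      ∃ u : List A, (∀ x ∈ u, a x ≠ 0) ∧ ∃ z, ∀ s ∈ F, u.foldl step s = z) :
    Tendsto (fun n => ∑' s, π s * distinctProb a step n s s₀) atTop (𝓝 0) := by
  set q : ℕ → ℝ≥0∞ := fun n => ∑' s, π s * distinctProb a step n s s₀ with hq
  have hanti : Antitone q := by
    refine antitone_nat_of_succ_le fun n => ?_
    refine ENNReal.tsum_le_tsum fun s => ?_
    gcongr
    rw [distinctProb_add]
    exact wordSum_mono a fun w => distinctProb_le h.sum_letters step 1 _ _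
  have hlim : Tendsto q atTop (𝓝 (⨅ n, q n)) := tendsto_atTop_iInf hanti
  set l := ⨅ n, q n with hl
  have hl1 : l ≤ 1 := (iInf_le q 0).trans <| by
    rw [hq, ← h.tsum_mul_const 1]
    refine ENNReal.tsum_le_tsum fun s => ?_
    gcongr
    exact (distinctProb_le h.sum_letters step 0 _ _).trans (by split_ifs <;> simp)
  have hltop : l ≠ ∞ := (hl1.trans_lt ENNReal.one_lt_top).ne
  have key : ∀ F : Finset S,
      l ≤ (∑' s, π s * if s ∈ F.filter (π · ≠ 0) then 0 else 1) +
        (∑' s, π s * if s ∈ F.filter (π · ≠ 0) then 0 else 1) / π s₀ := by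
    intro F
    set G := F.filter (π · ≠ 0) with hG
    set κ := ∑' s, π s * if s ∈ G then (0 : ℝ≥0∞) else 1 with hκ
    obtain ⟨u, hua, z, huz⟩ := hreset G fun s hs => (Finset.mem_filter.1 hs).2
    set δ := (u.map a).prod with hδ
    have hδ0 : δ ≠ 0 := by
      rw [hδ, Ne, List.prod_eq_zero_iff]
      simpa using hua
    have hδ1 : δ ≤ 1 := (prod_le_wordSum a u (fun _ => 1) le_rfl).trans
      (wordSum_const h.sum_letters _ 1).le
    have hδtop : δ ≠ ∞ := (hδ1.trans_lt ENNReal.one_lt_top).ne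
    have hstep : ∀ t, l + δ * q t ≤ q t + δ * (κ + κ / π s₀) := by
      intro t
      -- A stationary run starts at `s₀` with probability `π s₀` and is outside `G` at time `t` with
      -- probability `κ`.
      have h0 : wordSum a t (fun w => if w.foldl step s₀ ∈ G then 0 else 1) ≤ κ / π s₀ := by
        rw [ENNReal.le_div_iff_mul_le (Or.inl hs₀)
          (Or.inl (ne_of_lt ((ENNReal.le_tsum s₀).trans_lt (by rw [h.sum_states]; simp)))),
          mul_comm, hκ, ← h.tsum_wordSum t]
        exact ENNReal.le_tsum (f := fun s => π s * wordSum a t fun w =>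
          if w.foldl step s ∈ G then 0 else 1) s₀
      have h1 : ∀ s, distinctProb a step (t + u.length) s s₀ + δ * distinctProb a step t s s₀ ≤
          distinctProb a step t s s₀ + δ * (wordSum a t (fun w => if w.foldl step s ∈ G then 0 else 1)
            + wordSum a t (fun w => if w.foldl step s₀ ∈ G then 0 else 1)) := by
        intro s
        rw [distinctProb_add, distinctProb, ← wordSum_const_mul, ← wordSum_add, ← wordSum_add,
          ← wordSum_const_mul, ← wordSum_add]
        exact wordSum_mono a fun w => distinctProb_add_le h.sum_letters step huz _ _
      calc l + δ * q t ≤ q (t + u.length) + δ * q t := by gcongr; exact iInf_le q _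
        _ = ∑' s, π s * (distinctProb a step (t + u.length) s s₀ +
              δ * distinctProb a step t s s₀) := by
            simp only [hq, mul_add, ENNReal.tsum_add, ← ENNReal.tsum_mul_left, mul_left_comm]
        _ ≤ ∑' s, π s * (distinctProb a step t s s₀ +
              δ * (wordSum a t (fun w => if w.foldl step s ∈ G then 0 else 1)
              + wordSum a t (fun w => if w.foldl step s₀ ∈ G then 0 else 1))) :=
            ENNReal.tsum_le_tsum fun s => mul_le_mul_right (h1 s) _
        _ = q t + δ * (κ + wordSum a t (fun w => if w.foldl step s₀ ∈ G then 0 else 1)) := by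
            simp only [hq, mul_add, ENNReal.tsum_add]
            rw [hκ, ← h.tsum_wordSum t fun s => if s ∈ G then 0 else 1]
            simp only [mul_left_comm (π _) δ, ENNReal.tsum_mul_left, h.tsum_mul_const]
        _ ≤ _ := by gcongr
    have hlim1 : Tendsto (fun t => l + δ * q t) atTop (𝓝 (l + δ * l)) :=
      tendsto_const_nhds.add (ENNReal.Tendsto.const_mul hlim (Or.inr hδtop))
    have hlim2 : Tendsto (fun t => q t + δ * (κ + κ / π s₀)) atTop (𝓝 (l + δ * (κ + κ / π s₀))) :=
      hlim.add tendsto_const_nhds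
    have h2 := le_of_tendsto_of_tendsto' hlim1 hlim2 hstep
    rw [ENNReal.add_le_add_iff_left hltop] at h2
    rwa [ENNReal.mul_le_mul_iff_right hδ0 hδtop] at h2
  have hzero : l ≤ 0 := by
    have h1 := h.tendsto_compl.add
      (ENNReal.Tendsto.div_const h.tendsto_compl (b := π s₀) (Or.inr hs₀))
    rw [ENNReal.zero_div, add_zero] at h1
    exact ge_of_tendsto' h1 key
  rw [nonpos_iff_eq_zero.1 hzero] at hlim
  exact hlim

open Classical in
-- Coupling: runs from `s₀` and from a stationary state along the same letters give different values
-- of `f` only if they have not merged, at a cost of at most `K`.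
theorem IsStationaryLaw.wordSum_le (h : IsStationaryLaw a step π) (s₀ : S) (n : ℕ) {f : S → ℝ≥0∞}
    {K : ℝ≥0∞} (hf : ∀ s, f s ≤ K) :
    wordSum a n (fun w => f (w.foldl step s₀)) ≤
      ∑' s, π s * f s + K * ∑' s, π s * distinctProb a step n s s₀ := by
  rw [← h.tsum_mul_const (wordSum a n fun w => f (w.foldl step s₀)), ← h.tsum_wordSum n f,
    ← ENNReal.tsum_mul_left, ← ENNReal.tsum_add]
  refine ENNReal.tsum_le_tsum fun s => ?_
  rw [mul_left_comm, ← mul_add, distinctProb, ← wordSum_const_mul a n K, ← wordSum_add]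
  gcongr
  refine wordSum_mono a fun w => ?_
  split_ifs with h
  · simp [h]
  · simpa using le_add_left (hf _)

open Classical in
theorem IsStationaryLaw.le_wordSum (h : IsStationaryLaw a step π) (s₀ : S) (n : ℕ) {f : S → ℝ≥0∞}
    {K : ℝ≥0∞} (hf : ∀ s, f s ≤ K) :
    ∑' s, π s * f s ≤ wordSum a n (fun w => f (w.foldl step s₀)) +
      K * ∑' s, π s * distinctProb a step n s s₀ := by
  rw [← h.tsum_mul_const (wordSum a n fun w => f (w.foldl step s₀)), ← h.tsum_wordSum n f,
    ← ENNReal.tsum_mul_left, ← ENNReal.tsum_add]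
  refine ENNReal.tsum_le_tsum fun s => ?_
  rw [mul_left_comm, ← mul_add, distinctProb, ← wordSum_const_mul a n K, ← wordSum_add]
  gcongr
  refine wordSum_mono a fun w => ?_
  split_ifs with h
  · simp [h]
  · simpa using le_add_left (hf _)

theorem monotone_wordSum_of_le_cons {a : A → ℝ≥0∞} (ha : ∑ x, a x = 1) {f : List A → ℝ≥0∞}
    (hf : ∀ x w, f w ≤ f (x :: w)) : Monotone fun n => wordSum a n f := by
  refine monotone_nat_of_le_succ fun n => ?_
  calc wordSum a n f = ∑ x, a x * wordSum a n f := by rw [← Finset.sum_mul, ha, one_mul]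
    _ ≤ wordSum a (n + 1) f :=
      Finset.sum_le_sum fun x _ => by gcongr; exact wordSum_mono a fun w => hf x w

/-- The expectation of a statistic that does not decrease when letters are prepended increases to
the stationary expectation. -/
theorem IsStationaryLaw.tendsto_wordSum (h : IsStationaryLaw a step π) {s₀ : S} (hs₀ : π s₀ ≠ 0)
    (hreset : ∀ F : Finset S, (∀ s ∈ F, π s ≠ 0) →
      ∃ u : List A, (∀ x ∈ u, a x ≠ 0) ∧ ∃ z, ∀ s ∈ F, u.foldl step s = z) (D : S → ℕ)
    (hD : ∀ x w, D (List.foldl step s₀ w) ≤ D (List.foldl step s₀ (x :: w))) :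
    Tendsto (fun n => wordSum a n fun w => (D (w.foldl step s₀) : ℝ≥0∞)) atTop
      (𝓝 (∑' s, π s * D s)) := by
  have hq := h.tendsto_distinctProb hs₀ hreset
  have hmono : Monotone fun n => wordSum a n fun w => (D (w.foldl step s₀) : ℝ≥0∞) :=
    monotone_wordSum_of_le_cons h.sum_letters fun x w => by exact_mod_cast hD x w
  -- The coupling bounds need bounded statistics, hence the truncations of `D`.
  have hmin : ∀ r : ℕ, Monotone fun n =>
      wordSum a n fun w => ((min (D (w.foldl step s₀)) r : ℕ) : ℝ≥0∞) := fun r =>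
    monotone_wordSum_of_le_cons h.sum_letters fun x w => by
      exact_mod_cast min_le_min (hD x w) le_rfl
  have hle : ∀ (r : ℕ) (s : S), ((min (D s) r : ℕ) : ℝ≥0∞) ≤ r := fun r s => by
    exact_mod_cast min_le_right _ _
  have hqr : ∀ (r : ℕ) (c : ℝ≥0∞), Tendsto
      (fun n => c + (r : ℝ≥0∞) * ∑' s, π s * distinctProb a step n s s₀) atTop (𝓝 c) := by
    intro r c
    simpa using tendsto_const_nhds.add
      (ENNReal.Tendsto.const_mul hq (Or.inr (ENNReal.natCast_ne_top r)))
  convert tendsto_atTop_iSup hmono using 2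
  refine le_antisymm ?_ (iSup_le fun n => ?_)
  · rw [ENNReal.tsum_eq_iSup_sum]
    refine iSup_le fun G => ?_
    -- Truncation at this level does not change `D` on `G`.
    set r := G.sup D with hr
    refine ge_of_tendsto' (hqr r _) fun n => ?_
    calc ∑ s ∈ G, π s * (D s : ℝ≥0∞)
        = ∑ s ∈ G, π s * ((min (D s) r : ℕ) : ℝ≥0∞) :=
          Finset.sum_congr rfl fun s hs => by rw [min_eq_left (Finset.le_sup hs)]
      _ ≤ ∑' s, π s * ((min (D s) r : ℕ) : ℝ≥0∞) := ENNReal.sum_le_tsum _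
      _ ≤ _ := h.le_wordSum s₀ n (hle r)
      _ ≤ _ := by
        gcongr
        refine le_trans (wordSum_mono a fun w => ?_)
          (le_iSup (fun n => wordSum a n fun w => (D (w.foldl step s₀) : ℝ≥0∞)) n)
        exact_mod_cast min_le_left _ _
  -- At fixed `n` there are finitely many words, so truncating at a suitable `r` is harmless;
  -- monotonicity then replaces `n` by a large `m`, where the coupling error vanishes.
  · obtain ⟨r, hr⟩ : ∃ r, ∀ w : List A, w.length = n → D (w.foldl step s₀) ≤ r := by
      obtain ⟨r, hr⟩ := ((List.finite_length_eq A n).image fun w => D (w.foldl step s₀)).bddAbove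
      exact ⟨r, fun w hw => hr ⟨w, hw, rfl⟩⟩
    rw [wordSum_congr a (g := fun w => ((min (D (w.foldl step s₀)) r : ℕ) : ℝ≥0∞))
      fun w hw => by rw [min_eq_left (hr w hw)]]
    refine ge_of_tendsto (hqr r _) (eventually_atTop.2 ⟨n, fun m hm => ?_⟩)
    refine (hmin r hm).trans ((h.wordSum_le s₀ m (f := fun s => ((min (D s) r : ℕ) : ℝ≥0∞))
      (hle r)).trans ?_)
    gcongr
    exact_mod_cast min_le_left _ _

end WordSum

/-! ### Products of geometric laws -/

section Geometric

open scoped ENNReal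

theorem tsum_fin_prod {n : ℕ} (g : Fin n → ℕ → ℝ≥0∞) :
    ∑' s : Fin n → ℕ, ∏ i, g i (s i) = ∏ i, ∑' m, g i m := by
  induction n with
  | zero => simp
  | succ n ih =>
    rw [← (Fin.consEquiv fun _ : Fin (n + 1) => ℕ).tsum_eq, ENNReal.tsum_prod', Fin.prod_univ_succ,
      ← ih, ← ENNReal.tsum_mul_right]
    refine tsum_congr fun m => ?_
    rw [← ENNReal.tsum_mul_left]
    refine tsum_congr fun s => ?_
    simp [Fin.consEquiv, Fin.prod_univ_succ]

theorem tsum_pi_prod {ι : Type*} [Fintype ι] (g : ι → ℕ → ℝ≥0∞) :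
    ∑' s : ι → ℕ, ∏ i, g i (s i) = ∏ i, ∑' m, g i m := by
  set e := Fintype.equivFin ι
  rw [← (Equiv.arrowCongr e (Equiv.refl ℕ)).symm.tsum_eq]
  rw [← e.symm.prod_comp, ← tsum_fin_prod fun i => g (e.symm i)]
  refine tsum_congr fun s => ?_
  rw [← e.symm.prod_comp]
  simp [Equiv.arrowCongr]

variable {ι : Type*} [Fintype ι]

/-- The product of the geometric laws with ratios `ρ`. -/
noncomputable def geomWeight (ρ : ι → ℝ) (s : ι → ℕ) : ℝ≥0∞ :=
  ∏ q, ENNReal.ofReal ((1 - ρ q) * ρ q ^ s q)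

theorem tsum_ofReal_geometric {r : ℝ} (h0 : 0 ≤ r) (h1 : r < 1) :
    ∑' m : ℕ, ENNReal.ofReal ((1 - r) * r ^ m) = 1 := by
  have h2 : 0 < 1 - r := sub_pos.2 h1
  rw [← ENNReal.ofReal_tsum_of_nonneg (fun m => by positivity)
    ((summable_geometric_of_lt_one h0 h1).mul_left _), tsum_mul_left,
    tsum_geometric_of_lt_one h0 h1, mul_inv_cancel₀ h2.ne', ENNReal.ofReal_one]

theorem tsum_ofReal_geometric_mul {r : ℝ} (h0 : 0 ≤ r) (h1 : r < 1) :
    ∑' m : ℕ, ENNReal.ofReal ((1 - r) * r ^ m) * m = ENNReal.ofReal (r / (1 - r)) := by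
  have h2 : 0 < 1 - r := sub_pos.2 h1
  have h3 : ‖r‖ < 1 := by rwa [Real.norm_of_nonneg h0]
  have h4 : HasSum (fun m : ℕ => (1 - r) * r ^ m * m) (r / (1 - r)) := by
    have h5 := (hasSum_coe_mul_geometric_of_norm_lt_one h3).mul_left (1 - r)
    have h6 : (1 - r) * (r / (1 - r) ^ 2) = r / (1 - r) := by field_simp
    rw [h6] at h5
    have h7 : (fun m : ℕ => (1 - r) * r ^ m * m) = fun m : ℕ => (1 - r) * (m * r ^ m) :=
      funext fun m => by ring
    rw [h7]
    exact h5
  rw [← h4.tsum_eq, ENNReal.ofReal_tsum_of_nonneg (fun m => by positivity) h4.summable]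
  refine tsum_congr fun m => ?_
  rw [ENNReal.ofReal_mul (p := (1 - r) * r ^ m) (by positivity), ENNReal.ofReal_natCast]

theorem tsum_geomWeight {ρ : ι → ℝ} (h0 : ∀ q, 0 ≤ ρ q) (h1 : ∀ q, ρ q < 1) :
    ∑' s, geomWeight ρ s = 1 := by
  simp only [geomWeight]
  rw [tsum_pi_prod fun q m => ENNReal.ofReal ((1 - ρ q) * ρ q ^ m)]
  exact Finset.prod_eq_one fun q _ => tsum_ofReal_geometric (h0 q) (h1 q)

theorem tsum_geomWeight_mul {ρ : ι → ℝ} (h0 : ∀ q, 0 ≤ ρ q) (h1 : ∀ q, ρ q < 1) (p : ι) :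
    ∑' s, geomWeight ρ s * s p = ENNReal.ofReal (ρ p / (1 - ρ p)) := by
  classical
  have h : ∀ s : ι → ℕ, geomWeight ρ s * s p =
      ∏ q, (ENNReal.ofReal ((1 - ρ q) * ρ q ^ s q) * if q = p then (s q : ℝ≥0∞) else 1) := by
    intro s
    rw [Finset.prod_mul_distrib, geomWeight]
    simp
  simp only [h]
  rw [tsum_pi_prod fun q (m : ℕ) => ENNReal.ofReal ((1 - ρ q) * ρ q ^ m) *
    if q = p then (m : ℝ≥0∞) else 1, Finset.prod_eq_single p]
  · simpa using tsum_ofReal_geometric_mul (h0 p) (h1 p)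
  · intro q _ hq
    simpa [hq] using tsum_ofReal_geometric (h0 q) (h1 q)
  · simp

theorem geomWeight_update_succ [DecidableEq ι] {ρ : ι → ℝ} (h0 : ∀ q, 0 ≤ ρ q) (s : ι → ℕ) (p : ι) :
    geomWeight ρ (Function.update s p (s p + 1)) = geomWeight ρ s * ENNReal.ofReal (ρ p) := by
  rw [geomWeight, geomWeight, ← Finset.mul_prod_erase _ _ (Finset.mem_univ p),
    ← Finset.mul_prod_erase _ _ (Finset.mem_univ p), Function.update_self, pow_succ, ← mul_assoc,
    ENNReal.ofReal_mul' (h0 p), mul_right_comm]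
  congr 2
  refine Finset.prod_congr rfl fun q hq => ?_
  rw [Function.update_of_ne (Finset.ne_of_mem_erase hq)]

theorem geomWeight_zero_ne_zero {ρ : ι → ℝ} (h1 : ∀ q, ρ q < 1) : geomWeight ρ 0 ≠ 0 := by
  simp only [geomWeight, Finset.prod_ne_zero_iff]
  intro q _
  simp [h1 q]

/-- A geometric law of ratio `0` sits at `0`. Thus charged states vanish at the pairs that are not
queues. -/
theorem eq_zero_of_geomWeight_ne_zero {ρ : ι → ℝ} {s : ι → ℕ} (hs : geomWeight ρ s ≠ 0) {q : ι}
    (hq : ρ q = 0) : s q = 0 := by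
  by_contra h
  refine hs (Finset.prod_eq_zero (Finset.mem_univ q) ?_)
  simp [hq, h]

end Geometric

/-! ### The stationary law of the queues -/

section Stationary

open scoped ENNReal

variable {d : ℕ}

/-- The traffic intensity of the queue at `(i, j)`. -/
noncomputable def intensity (α : Fin d → ℝ) (q : Fin d × Fin d) : ℝ :=
  if q.1 < q.2 then α q.2 / α q.1 else 0

variable {α : Fin d → ℝ}

theorem intensity_nonneg (h0 : ∀ i, 0 ≤ α i) (q : Fin d × Fin d) : 0 ≤ intensity α q := by
  unfold intensity
  split_ifs
  · exact div_nonneg (h0 _) (h0 _)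
  · exact le_rfl

theorem intensity_lt_one (h0 : ∀ i, 0 ≤ α i) (hα : StrictAnti α) (q : Fin d × Fin d) :
    intensity α q < 1 := by
  unfold intensity
  split_ifs with h
  · exact (div_lt_one ((h0 _).trans_lt (hα h))).2 (hα h)
  · exact one_pos

/-- A join multiplies the weight of the state by `α j / α i` and turns the token weight `α j` into
`α i`, so the product is kept. A release is the inverse of a join. -/
theorem weight_cellMove (h0 : ∀ i, 0 ≤ α i) (hα : StrictAnti α) {i j : Fin d} (hij : i < j)
    (p : (Fin d × Fin d → ℕ) × Fin d) :
    geomWeight (intensity α) (cellMove i j p).1 * ENNReal.ofReal (α (cellMove i j p).2) =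
      geomWeight (intensity α) p.1 * ENNReal.ofReal (α p.2) := by
  have join : ∀ s : Fin d × Fin d → ℕ,
      geomWeight (intensity α) (cellMove i j (s, j)).1 * ENNReal.ofReal (α (cellMove i j (s, j)).2) =
        geomWeight (intensity α) s * ENNReal.ofReal (α j) := by
    intro s
    rw [cellMove_join]
    simp only
    rw [geomWeight_update_succ (intensity_nonneg h0), mul_assoc,
      ← ENNReal.ofReal_mul (intensity_nonneg h0 _)]
    have : α i ≠ 0 := ((h0 j).trans_lt (hα hij)).ne'
    simp [intensity, hij, this]
  obtain ⟨s, t⟩ := p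
  by_cases hj : t = j
  · subst hj; exact join s
  · by_cases hi : t = i ∧ 0 < s (i, j)
    · have h2 : (cellMove i j (s, t)).2 = j := by simp [cellMove, hi, hij.ne]
      have h3 := join (cellMove i j (s, t)).1
      have h4 : ((cellMove i j (s, t)).1, j) = cellMove i j (s, t) := Prod.ext rfl h2.symm
      rw [h4, cellMove_involutive hij.ne] at h3
      rw [h2, ← h3]
    · have h1 : cellMove i j (s, t) = (s, t) := by
        simp only [cellMove, hj, hi, if_false]
      rw [h1]

/-- Change of variables along a weight-preserving involution. -/
theorem tsum_cellMove (h0 : ∀ i, 0 ≤ α i) (hα : StrictAnti α) {i j : Fin d} (hij : i < j)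
    (g : (Fin d × Fin d → ℕ) × Fin d → ℝ≥0∞) :
    ∑' p, geomWeight (intensity α) p.1 * ENNReal.ofReal (α p.2) * g (cellMove i j p) =
      ∑' p, geomWeight (intensity α) p.1 * ENNReal.ofReal (α p.2) * g p := by
  rw [← ((cellMove_involutive hij.ne).toPerm).tsum_eq]
  refine tsum_congr fun p => ?_
  simp only [Function.Involutive.coe_toPerm]
  rw [weight_cellMove h0 hα hij, cellMove_involutive hij.ne]

theorem tsum_cellsPass (h0 : ∀ i, 0 ≤ α i) (hα : StrictAnti α) {i : Fin d} {l : List (Fin d)}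
    (hl : ∀ j ∈ l, i < j) (g : (Fin d × Fin d → ℕ) × Fin d → ℝ≥0∞) :
    ∑' p, geomWeight (intensity α) p.1 * ENNReal.ofReal (α p.2) * g (cellsPass i l p) =
      ∑' p, geomWeight (intensity α) p.1 * ENNReal.ofReal (α p.2) * g p := by
  induction l with
  | nil => rfl
  | cons j l ih =>
    rw [← ih fun j hj => hl j (List.mem_cons_of_mem _ hj)]
    exact tsum_cellMove h0 hα (hl j List.mem_cons_self) fun p => g (cellsPass i l p)

theorem tsum_rowsPass (h0 : ∀ i, 0 ≤ α i) (hα : StrictAnti α) (l : List (Fin d))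
    (g : (Fin d × Fin d → ℕ) × Fin d → ℝ≥0∞) :
    ∑' p, geomWeight (intensity α) p.1 * ENNReal.ofReal (α p.2) * g (rowsPass l p) =
      ∑' p, geomWeight (intensity α) p.1 * ENNReal.ofReal (α p.2) * g p := by
  induction l with
  | nil => rfl
  | cons i l ih =>
    rw [← ih]
    exact tsum_cellsPass h0 hα (by simp) fun p => g (rowsPass l p)

/-- The joint law of state and token is invariant under the whole passage; for functions of the
state alone the token weights sum to one. -/
theorem isStationaryLaw_geomWeight (h0 : ∀ i, 0 ≤ α i) (h1 : ∑ i, α i = 1) (hα : StrictAnti α) :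
    IsStationaryLaw (fun i => ENNReal.ofReal (α i)) queueInsert (geomWeight (intensity α)) := by
  have hsum : ∑ i, ENNReal.ofReal (α i) = 1 := by
    rw [← ENNReal.ofReal_sum_of_nonneg fun i _ => h0 i, h1, ENNReal.ofReal_one]
  refine ⟨hsum, tsum_geomWeight (intensity_nonneg h0) (intensity_lt_one h0 hα), fun f => ?_⟩
  have h := tsum_rowsPass h0 hα (List.finRange d) fun p => f p.1
  rw [ENNReal.tsum_prod', ENNReal.tsum_prod'] at h
  simp only [tsum_fintype, mul_assoc, ← Finset.mul_sum, ← Finset.sum_mul, hsum, one_mul] at h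
  exact h

theorem tendsto_wordSum_largeCount (h0 : ∀ i, 0 ≤ α i) (h1 : ∑ i, α i = 1) (hα : StrictAnti α)
    (k : Fin d) :
    Tendsto (fun n => wordSum (fun i => ENNReal.ofReal (α i)) n
        fun w => (largeCount k (queueRun 0 w) : ℝ≥0∞)) atTop
      (𝓝 (ENNReal.ofReal (∑ i ∈ Finset.Iic k, ∑ j ∈ Finset.Ioi k, α j / (α i - α j)))) := by
  have h := (isStationaryLaw_geomWeight h0 h1 hα).tendsto_wordSum (s₀ := 0)
    (geomWeight_zero_ne_zero (intensity_lt_one h0 hα)) (fun F hF => ?_) (largeCount k)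
    fun x w => largeCount_le_cons k x w
  · suffices hE : ∑' s, geomWeight (intensity α) s * (largeCount k s : ℝ≥0∞) =
        ENNReal.ofReal (∑ i ∈ Finset.Iic k, ∑ j ∈ Finset.Ioi k, α j / (α i - α j)) by
      rw [← hE]; exact h
    have hlt : ∀ i ∈ Finset.Iic k, ∀ j ∈ Finset.Ioi k, i < j := fun i hi j hj =>
      (Finset.mem_Iic.1 hi).trans_lt (Finset.mem_Ioi.1 hj)
    have hnn : ∀ i ∈ Finset.Iic k, ∀ j ∈ Finset.Ioi k, 0 ≤ α j / (α i - α j) := fun i hi j hj =>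
      div_nonneg (h0 j) (sub_nonneg.2 (hα (hlt i hi j hj)).le)
    simp only [largeCount, Nat.cast_sum, Finset.mul_sum]
    rw [Summable.tsum_finsetSum fun _ _ => ENNReal.summable,
      ENNReal.ofReal_sum_of_nonneg fun i hi => Finset.sum_nonneg (hnn i hi)]
    refine Finset.sum_congr rfl fun i hi => ?_
    rw [Summable.tsum_finsetSum fun _ _ => ENNReal.summable,
      ENNReal.ofReal_sum_of_nonneg (hnn i hi)]
    refine Finset.sum_congr rfl fun j hj => ?_
    have hij := hlt i hi j hj
    rw [tsum_geomWeight_mul (intensity_nonneg h0) (intensity_lt_one h0 hα) (i, j)]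
    have h2 : α i ≠ 0 := ((h0 j).trans_lt (hα hij)).ne'
    have h3 : α i - α j ≠ 0 := (sub_pos.2 (hα hij)).ne'
    congr 1
    simp only [intensity, hij, if_true]
    field_simp
  · obtain ⟨u, hu, -, huF⟩ := exists_word_reset_finset F fun s hs q hq =>
      eq_zero_of_geomWeight_ne_zero (hF s hs) (by simp [intensity, hq])
    refine ⟨u, fun x hx => ?_, 0, huF⟩
    have hx' := hu x hx
    -- Only the last letter can have probability zero, and the reset word avoids it.
    have : α ⟨x + 1, hx'⟩ < α x := hα (Fin.lt_def.2 (Nat.lt_succ_self _))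
    simpa using (h0 _).trans_lt this

end Stationary

/-! ### The excess as an expectation over words -/

section Excess

open scoped ENNReal NNReal

variable {d : ℕ}

theorem sum_prod_ofFn_eq_wordSum {A R : Type*} [Fintype A] [CommSemiring R] (a : A → R) (n : ℕ)
    (f : List A → R) : ∑ w : Fin n → A, (∏ i, a (w i)) * f (List.ofFn w) = wordSum a n f := by
  induction n generalizing f with
  | zero => simp [wordSum]
  | succ n ih =>
    rw [← (Fin.consEquiv fun _ : Fin (n + 1) => A).sum_comp, Fintype.sum_prod_type, wordSum]
    refine Finset.sum_congr rfl fun x _ => ?_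
    rw [← ih, Finset.mul_sum]
    refine Finset.sum_congr rfl fun w _ => ?_
    simp [Fin.consEquiv, Fin.prod_univ_succ, mul_assoc]

theorem continuous_wordSum {A : Type*} [Fintype A] (n : ℕ) (f : List A → ℝ) :
    Continuous fun a : A → ℝ => wordSum a n f := by
  induction n generalizing f with
  | zero => exact continuous_const
  | succ n ih =>
    exact continuous_finsetSum _ fun x _ => (continuous_apply x).mul (ih _)

theorem letterLaw_singleton (α : Fin d → ℝ) (x : Fin d) :
    letterLaw α {x} = ENNReal.ofReal (α x) := by
  simp [letterLaw, Set.indicator_apply]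

instance isFiniteMeasure_letterLaw (α : Fin d → ℝ) : IsFiniteMeasure (letterLaw α) := by
  refine ⟨?_⟩
  simp [letterLaw]

theorem wordSum_countP (α : Fin d → ℝ) (hα : ∑ i, α i = 1) (k : Fin d) (n : ℕ) :
    wordSum α n (fun w => (w.countP (· ≤ k) : ℝ)) = (∑ i ∈ Finset.Iic k, α i) * n := by
  induction n with
  | zero => simp [wordSum]
  | succ n ih =>
    simp only [wordSum, List.countP_cons, Nat.cast_add, wordSum_add, ih, mul_add,
      Finset.sum_add_distrib, ← Finset.sum_mul, hα, wordSum_const hα]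
    simp only [decide_eq_true_eq, Nat.cast_ite, Nat.cast_one, Nat.cast_zero, mul_ite, mul_one,
      mul_zero, one_mul]
    rw [← Finset.sum_filter]
    congr 2
    ext i; simp

theorem sum_shRSK {n : ℕ} (k : Fin d) (w : Fin n → Fin d) :
    ∑ i ∈ Finset.Iic k, shRSK w i = topSize (k + 1) (insertionTableau (List.ofFn w)) := by
  rw [topSize_eq_sum]
  rfl

/-- The expected number of letters `≤ k` cancels the centring. The resulting sum is a polynomial in
`α`, and no ordering of `α` is needed. -/
theorem excess_eq_wordSum {α : Fin d → ℝ} (hα : α ∈ stdSimplex ℝ (Fin d)) (n : ℕ) (k : Fin d) :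
    excess n k α = wordSum α n fun w => (largeCount k (queueRun 0 w) : ℝ) := by
  have : IsFiniteMeasure (wordLaw n α) := by unfold wordLaw; infer_instance
  have hreal : ∀ w : Fin n → Fin d, (wordLaw n α).real {w} = ∏ i, α (w i) := by
    intro w
    rw [Measure.real, wordLaw, Measure.pi_singleton, ENNReal.toReal_prod]
    refine Finset.prod_congr rfl fun i _ => ?_
    rw [letterLaw_singleton, ENNReal.toReal_ofReal (hα.1 _)]
  rw [excess, schurWeyl, integral_map (Measurable.of_discrete).aemeasurable
    (Measurable.of_discrete).aestronglyMeasurable, integral_fintype Integrable.of_finite]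
  set F : List (Fin d) → ℝ := fun l => (largeCount k (queueRun 0 l) : ℝ) +
    ((l.countP (· ≤ k) : ℝ) + -((∑ i ∈ Finset.Iic k, α i) * (n : ℝ))) with hF
  have h2 : ∀ w : Fin n → Fin d, (wordLaw n α).real {w} •
      ((∑ i ∈ Finset.Iic k, (shRSK w i : ℝ)) - (∑ i ∈ Finset.Iic k, α i) * (n : ℝ)) =
      (∏ i, α (w i)) * F (List.ofFn w) := by
    intro w
    rw [hreal, ← Nat.cast_sum, sum_shRSK, topSize_insertionTableau_eq, smul_eq_mul]
    push_cast
    ring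
  have h3 : wordSum α n F = wordSum α n fun w => (largeCount k (queueRun 0 w) : ℝ) := by
    rw [hF, wordSum_add, wordSum_add, wordSum_const hα.2, wordSum_countP α hα.2]
    ring
  rw [← h3, ← sum_prod_ofFn_eq_wordSum]
  exact Finset.sum_congr rfl fun w _ => h2 w

theorem wordSum_ofReal {A : Type*} [Fintype A] {a : A → ℝ} (ha : ∀ x, 0 ≤ a x) (n : ℕ)
    (f : List A → ℕ) :
    wordSum (fun x => ENNReal.ofReal (a x)) n (fun w => (f w : ℝ≥0∞)) =
      ENNReal.ofReal (wordSum a n fun w => (f w : ℝ)) := by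
  have h1 := map_wordSum ENNReal.ofNNRealHom (fun x => (a x).toNNReal) n fun w => (f w : ℝ≥0)
  have h2 := map_wordSum NNReal.toRealHom (fun x => (a x).toNNReal) n fun w => (f w : ℝ≥0)
  simp only [NNReal.coe_toRealHom, Real.coe_toNNReal _ (ha _), NNReal.coe_natCast] at h2
  rw [← h2, ENNReal.ofReal_coe_nnreal]
  exact h1.symm

theorem wordSum_natCast_nonneg {A : Type*} [Fintype A] {a : A → ℝ} (ha : ∀ x, 0 ≤ a x) (n : ℕ)
    (f : List A → ℕ) : 0 ≤ wordSum a n fun w => (f w : ℝ) := by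
  induction n generalizing f with
  | zero => exact Nat.cast_nonneg _
  | succ n ih => exact Finset.sum_nonneg fun x _ => mul_nonneg (ha x) (ih _)

/-! ### Monotonicity, limit and bound -/

theorem excess_monotone {α : Fin d → ℝ} (hα : α ∈ stdSimplex ℝ (Fin d)) (k : Fin d) :
    Monotone fun n => excess n k α := by
  intro m n hmn
  simp only [excess_eq_wordSum hα]
  rw [← ENNReal.ofReal_le_ofReal_iff (wordSum_natCast_nonneg hα.1 _ _), ← wordSum_ofReal hα.1,
    ← wordSum_ofReal hα.1]
  refine monotone_wordSum_of_le_cons ?_ (fun x w => ?_) hmn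
  · rw [← ENNReal.ofReal_sum_of_nonneg fun i _ => hα.1 i, hα.2, ENNReal.ofReal_one]
  · exact_mod_cast largeCount_le_cons k x w

theorem tendsto_excess {α : Fin d → ℝ} (hα : α ∈ stdSimplex ℝ (Fin d)) (hanti : StrictAnti α)
    (k : Fin d) : Tendsto (fun n => excess n k α) atTop
      (𝓝 (∑ i ∈ Finset.Iic k, ∑ j ∈ Finset.Ioi k, α j / (α i - α j))) := by
  have h := tendsto_wordSum_largeCount hα.1 hα.2 hanti k
  simp only [wordSum_ofReal hα.1, ← excess_eq_wordSum hα] at h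
  have h' := (ENNReal.tendsto_toReal ENNReal.ofReal_ne_top).comp h
  have hnn : 0 ≤ ∑ i ∈ Finset.Iic k, ∑ j ∈ Finset.Ioi k, α j / (α i - α j) :=
    Finset.sum_nonneg fun i hi => Finset.sum_nonneg fun j hj => div_nonneg (hα.1 j)
      (sub_nonneg.2 (hanti ((Finset.mem_Iic.1 hi).trans_lt (Finset.mem_Ioi.1 hj))).le)
  rw [ENNReal.toReal_ofReal hnn] at h'
  refine h'.congr fun n => ENNReal.toReal_ofReal ?_
  rw [excess_eq_wordSum hα]
  exact wordSum_natCast_nonneg hα.1 _ _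

theorem itwBound_eq_coe {α : Fin d → ℝ} (k : Fin d)
    (h : ∀ i ∈ Finset.Iic k, ∀ j ∈ Finset.Ioi k, α i ≠ α j) :
    itwBound k α =
      ((∑ i ∈ Finset.Iic k, ∑ j ∈ Finset.Ioi k, α j / (α i - α j) : ℝ) : EReal) := by
  have hc : ∀ (s : Finset (Fin d)) (f : Fin d → ℝ),
      ((∑ i ∈ s, f i : ℝ) : EReal) = ∑ i ∈ s, (f i : EReal) := fun s f =>
    map_sum (⟨⟨Real.toEReal, EReal.coe_zero⟩, EReal.coe_add⟩ : ℝ →+ EReal) f s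
  rw [itwBound, hc]
  refine Finset.sum_congr rfl fun i hi => ?_
  rw [hc]
  exact Finset.sum_congr rfl fun j hj => if_neg (h i hi j hj)

/-- Nonnegativity of the other summands, which comes from the ordering of `α`, lets the single
infinite summand bound the sum from below. -/
theorem itwBound_eq_top {α : Fin d → ℝ} (h0 : ∀ i, 0 ≤ α i) (hanti : Antitone α) {k i j : Fin d}
    (hi : i ∈ Finset.Iic k) (hj : j ∈ Finset.Ioi k) (hij : α i = α j) : itwBound k α = ⊤ := by
  classical
  have hnn : ∀ i ∈ Finset.Iic k, ∀ j ∈ Finset.Ioi k,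
      (0 : EReal) ≤ if α i = α j then (⊤ : EReal) else ((α j / (α i - α j) : ℝ) : EReal) := by
    intro i hi j hj
    split_ifs
    · exact le_top
    · exact EReal.coe_nonneg.2 (div_nonneg (h0 j) (sub_nonneg.2
        (hanti ((Finset.mem_Iic.1 hi).trans_lt (Finset.mem_Ioi.1 hj)).le)))
  rw [eq_top_iff]
  calc (⊤ : EReal) = if α i = α j then (⊤ : EReal) else ((α j / (α i - α j) : ℝ) : EReal) :=
        (if_pos hij).symm
    _ ≤ ∑ j ∈ Finset.Ioi k,
          if α i = α j then (⊤ : EReal) else ((α j / (α i - α j) : ℝ) : EReal) :=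
        Finset.single_le_sum (f := fun j => if α i = α j then (⊤ : EReal)
          else ((α j / (α i - α j) : ℝ) : EReal)) (hnn i hi) hj
    _ ≤ itwBound k α := by
        unfold itwBound
        convert Finset.single_le_sum (f := fun i => ∑ j ∈ Finset.Ioi k, if α i = α j then (⊤ : EReal)
          else ((α j / (α i - α j) : ℝ) : EReal)) (fun i hi => Finset.sum_nonneg (hnn i hi)) hi

theorem exists_strictAnti_mem_stdSimplex (hd : 0 < d) :
    ∃ γ : Fin d → ℝ, γ ∈ stdSimplex ℝ (Fin d) ∧ StrictAnti γ := by
  set c : ℝ := ∑ i : Fin d, ((d : ℝ) - i) with hc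
  have hpos : ∀ i : Fin d, 0 < (d : ℝ) - i := fun i => sub_pos.2 (by exact_mod_cast i.2)
  have hcpos : 0 < c := Finset.sum_pos (fun i _ => hpos i) ⟨⟨0, hd⟩, Finset.mem_univ _⟩
  refine ⟨fun i => ((d : ℝ) - i) / c, ⟨fun i => (div_pos (hpos i) hcpos).le, ?_⟩, fun i j hij => ?_⟩
  · rw [← Finset.sum_div, div_self hcpos.ne']
  · have : (i : ℝ) < j := by exact_mod_cast hij
    exact div_lt_div_of_pos_right (by linarith) hcpos

/-- Ties within the first `k` and within the remaining letters are removed by perturbation. -/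
theorem excess_le {α : Fin d → ℝ} (hα : α ∈ stdSimplex ℝ (Fin d)) (hanti : Antitone α) (k : Fin d)
    (h : ∀ i ∈ Finset.Iic k, ∀ j ∈ Finset.Ioi k, α i ≠ α j) (n : ℕ) :
    excess n k α ≤ ∑ i ∈ Finset.Iic k, ∑ j ∈ Finset.Ioi k, α j / (α i - α j) := by
  obtain ⟨γ, hγ, hγanti⟩ := exists_strictAnti_mem_stdSimplex k.pos
  set β : ℝ → Fin d → ℝ := fun t => (1 - t) • α + t • γ with hβ
  have hβc : Continuous β := by fun_prop
  have hβ0 : β 0 = α := by simp [hβ]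
  have hlim : Tendsto β (𝓝[>] 0) (𝓝 α) := by
    have := (hβc.tendsto 0).mono_left (nhdsWithin_le_nhds (s := Set.Ioi (0 : ℝ)))
    rwa [hβ0] at this
  have hlim_apply : ∀ i, Tendsto (fun t => β t i) (𝓝[>] 0) (𝓝 (α i)) := fun i =>
    ((continuous_apply i).tendsto α).comp hlim
  have h1 : Tendsto (fun t => wordSum (β t) n fun w => (largeCount k (queueRun 0 w) : ℝ)) (𝓝[>] 0)
      (𝓝 (excess n k α)) := by
    rw [excess_eq_wordSum hα]
    exact ((continuous_wordSum n _).tendsto α).comp hlim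
  have h2 : Tendsto (fun t => ∑ i ∈ Finset.Iic k, ∑ j ∈ Finset.Ioi k, β t j / (β t i - β t j))
      (𝓝[>] 0) (𝓝 (∑ i ∈ Finset.Iic k, ∑ j ∈ Finset.Ioi k, α j / (α i - α j))) :=
    tendsto_finsetSum _ fun i hi => tendsto_finsetSum _ fun j hj =>
      (hlim_apply j).div ((hlim_apply i).sub (hlim_apply j)) (sub_ne_zero.2 (h i hi j hj))
  refine le_of_tendsto_of_tendsto h1 h2 ?_
  filter_upwards [Ioo_mem_nhdsGT (zero_lt_one' ℝ)] with t ht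
  have hβS : β t ∈ stdSimplex ℝ (Fin d) :=
    convex_stdSimplex ℝ (Fin d) hα hγ (sub_nonneg.2 ht.2.le) ht.1.le (by ring)
  have hβanti : StrictAnti (β t) := fun i j hij => by
    simp only [hβ, Pi.add_apply, Pi.smul_apply, smul_eq_mul]
    have h3 : (1 - t) * α j ≤ (1 - t) * α i :=
      mul_le_mul_of_nonneg_left (hanti hij.le) (sub_nonneg.2 ht.2.le)
    have h4 : t * γ j < t * γ i := mul_lt_mul_of_pos_left (hγanti hij) ht.1
    linarith
  rw [← excess_eq_wordSum hβS]
  exact (excess_monotone hβS k).ge_of_tendsto (tendsto_excess hβS hβanti k) n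

end Excess

theorem theorem1 {d : ℕ} (α : Fin d → ℝ) (hα : α ∈ stdSimplex ℝ (Fin d)) (hsorted : Antitone α)
    (k : Fin d) :
    (∀ n : ℕ, ((excess n k α : ℝ) : EReal) ≤ itwBound k α) ∧
    (Function.Injective α →
      Monotone (fun n : ℕ => excess n k α) ∧
      Tendsto (fun n : ℕ => ((excess n k α : ℝ) : EReal)) atTop (𝓝 (itwBound k α))) := by
  refine ⟨fun n => ?_, fun hinj => ⟨excess_monotone hα k, ?_⟩⟩
  -- Only ties across `k` matter here: they make the bound infinite.
  · by_cases h : ∀ i ∈ Finset.Iic k, ∀ j ∈ Finset.Ioi k, α i ≠ α j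
    · rw [itwBound_eq_coe k h, EReal.coe_le_coe_iff]
      exact excess_le hα hsorted k h n
    · push Not at h
      obtain ⟨i, hi, j, hj, hij⟩ := h
      rw [itwBound_eq_top hα.1 hsorted hi hj hij]
      exact le_top
  · rw [itwBound_eq_coe k fun i hi j hj hij =>
      ((Finset.mem_Iic.1 hi).trans_lt (Finset.mem_Ioi.1 hj)).ne (hinj hij), EReal.tendsto_coe]
    exact tendsto_excess hα (hsorted.strictAnti_of_injective hinj) k
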